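/- Let $p\in\mathbb{Z}$, let $n\ge 2$ be an integer, and let $\eta=e^{\pi i/n}$. For $h\in\mathbb{Z}$ put $\mathcal{Z}_h=\sum_{j=0}^{n-1}\eta^{j(1-h)}$, and let $B_k(y)$ be the Bernoulli polynomials, $\frac{te^{ty}}{e^t-1}=\sum_{k\ge 0}B_k(y)\frac{t^k}{k!}$. Then the series below converges absolutely and $$\mathcal{Z}_{2p+1}\sum_{m\in\mathbb{Z}\setminus\{0\}}\frac{(-1)^m}{\Bigl(\prod_{j=1}^{n-1}\sinh(m\pi i\eta^j)\Bigr)m^{2p+1-n}}=-\frac{2^{n-1}(2\pi i)^{2p+1-n}}{\eta^{n(n-1)/2}}\sum_{\substack{m_1,\dots,m_n\ge 0\\ m_1+\cdots+m_n=p}}\ \prod_{\nu=1}^{n}\frac{B_{2m_\nu}(1/2)}{(2m_\nu)!}\,\eta^{2(\nu-1)m_\nu},$$ where the sum on the right is over integers $m_\nu$ and an empty sum is $0$. Furthermore, let $\zeta_n(s,\tfrac{1}{1-\eta};1,\eta,\dots,\eta^{n-1})$ be the Barnes zeta-function, that is, the meromorphic continuation to $s\in\mathbb{C}$ of the Dirichlet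 series $$\sum_{m_1,\dots,m_n\ge 0}\Bigl(\tfrac{1}{1-\eta}+m_1+\eta m_2+\cdots+\eta^{n-1}m_n\Bigr)^{-s},$$ which converges absolutely for $\operatorname{Re}s>n$ (principal powers). If $p\ge n/2$, then this continuation exists and is holomorphic at $s=n-2p$, and both sides of the identity above are equal to $$\frac{(2\pi i)^{2p+1-n}(-1)^{1-n}\,2^{n-1}}{(2p-n)!}\;\zeta_n\Bigl(n-2p,\tfrac{1}{1-\eta};1,\eta,\dots,\eta^{n-1}\Bigr).$$ -/

import Mathlib

/-- `η = e^{πi/n}`, the standard primitive `2n`-th root of unity. -/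
noncomputable def etaRoot (n : ℕ) : ℂ := Complex.exp (Real.pi * Complex.I / n)

/-- `𝒵_h = ∑_{j=0}^{n-1} η^{j(1-h)}` for an integer `h`. -/
noncomputable def calZ (n : ℕ) (h : ℤ) : ℂ :=
  ∑ j ∈ Finset.range n, etaRoot n ^ ((j : ℤ) * (1 - h))

/-- The `m`-th term `(-1)^m / ((∏_{j=1}^{n-1} sinh(mπi η^j)) m^{2p+1-n})`. -/
noncomputable def sinhTerm (n : ℕ) (p m : ℤ) : ℂ :=
  (-1) ^ m /
    ((∏ j ∈ Finset.Icc 1 (n - 1), Complex.sinh (m * Real.pi * Complex.I * etaRoot n ^ j)) *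
      (m : ℂ) ^ (2 * p + 1 - (n : ℤ)))

/-- The tuples `(m_1, …, m_n)` of non-negative integers with `m_1 + ⋯ + m_n = p`
(none if `p < 0`), as a finite set; see `mem_tuplesWithSum`. -/
def tuplesWithSum (n : ℕ) (p : ℤ) : Finset (Fin n → ℕ) :=
  (Fintype.piFinset fun _ => Finset.range (p.toNat + 1)).filter
    fun m => ((∑ ν, m ν : ℕ) : ℤ) = p

theorem mem_tuplesWithSum (n : ℕ) (p : ℤ) (m : Fin n → ℕ) :
    m ∈ tuplesWithSum n p ↔ ((∑ ν, m ν : ℕ) : ℤ) = p := by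
  simp only [tuplesWithSum, Finset.mem_filter, Fintype.mem_piFinset, Finset.mem_range,
    and_iff_right_iff_imp]
  intro h ν
  have := Finset.single_le_sum (f := m) (fun i _ => Nat.zero_le _) (Finset.mem_univ ν)
  omega

/-- The value `B_k(1/2)` of the `k`-th Bernoulli polynomial, as a complex number. -/
noncomputable def bernoulliHalf (k : ℕ) : ℂ :=
  (((Polynomial.bernoulli k).eval (1 / 2 : ℚ) : ℚ) : ℂ)

/-- The Barnes zeta-function with parameters `a, ω_1, …, ω_n`, as a predicate on `Z`: on
`Re s > n` the function `Z` is the (convergent) series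
`∑_{m_1, …, m_n ≥ 0} (a + ω_1 m_1 + ⋯ + ω_n m_n)^{-s}`, and `Z` is meromorphic on all of `ℂ`.
The normal form only fixes the values at the poles (to be `0`) and removes removable
singularities. Powers are principal, which is the intended branch when `a` and the `ω_j` lie in an
open half-plane `Re (e^{-iθ} z) > 0` with `|θ| ≤ π/2`. -/
structure IsBarnesZeta {n : ℕ} (a : ℂ) (ω : Fin n → ℂ) (Z : ℂ → ℂ) : Prop where
  hasSum : ∀ s : ℂ, (n : ℝ) < s.re →
    HasSum (fun m : Fin n → ℕ => 1 / (a + ∑ j, ω j * (m j : ℂ)) ^ s) (Z s)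
  meromorphic : MeromorphicNFOn Z Set.univ

theorem IsBarnesZeta.unique {n : ℕ} {a : ℂ} {ω : Fin n → ℂ} {Z W : ℂ → ℂ}
    (hZ : IsBarnesZeta a ω Z) (hW : IsBarnesZeta a ω W) : Z = W := by
  have hmer : MeromorphicOn (Z - W) Set.univ :=
    hZ.meromorphic.meromorphicOn.sub hW.meromorphic.meromorphicOn
  have h0 : meromorphicOrderAt (Z - W) ((n : ℂ) + 1) = ⊤ := by
    rw [meromorphicOrderAt_eq_top_iff]
    apply Filter.Eventually.filter_mono nhdsWithin_le_nhds
    have hopen : IsOpen {s : ℂ | (n : ℝ) < s.re} :=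
      isOpen_lt continuous_const Complex.continuous_re
    filter_upwards [hopen.mem_nhds (show ((n : ℂ) + 1) ∈ {s : ℂ | (n : ℝ) < s.re} by simp)]
      with s hs
    simp [(hZ.hasSum s hs).unique (hW.hasSum s hs)]
  funext x
  have hx : meromorphicOrderAt (Z - W) x = ⊤ := by
    by_contra hne
    exact hmer.meromorphicOrderAt_ne_top_of_isPreconnected isPreconnected_univ
      (Set.mem_univ x) (Set.mem_univ _) hne h0
  rw [meromorphicOrderAt_eq_top_iff] at hx
  have hev : Z =ᶠ[nhdsWithin x {x}ᶜ] W := by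
    filter_upwards [hx] with s hs
    exact sub_eq_zero.mp hs
  exact (((hZ.meromorphic (Set.mem_univ x)).eventuallyEq_nhdsNE_iff_eventuallyEq_nhds
    (hW.meromorphic (Set.mem_univ x))).mp hev).eq_of_nhds

open Classical in
/-- The Barnes zeta-function `s ↦ ζ_n(s, a; ω_1, …, ω_n)`: the meromorphic continuation to `ℂ` of
the Dirichlet series (`0` if there is none; there is at most one by `IsBarnesZeta.unique`). -/
noncomputable def barnesZeta {n : ℕ} (s a : ℂ) (ω : Fin n → ℂ) : ℂ :=
  if h : ∃ Z : ℂ → ℂ, IsBarnesZeta a ω Z then h.choose s else 0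

/-!
Both identities come from the function
`K(z) = z^(n-1-2p) / ∏_{j<n} sinh (πi η^j z)` and from the Taylor series at `0` of
`H(z) = ∏_{j<n} (η^j z / 2) / sinh (η^j z / 2)`.

*The series.* Since `(z / 2) / sinh (z / 2) = ∑ B_k(1/2) z^k / k!` (`hasTaylorSeries_halfDivSinh`)
and `B_k(1/2) = 0` for odd `k`, the coefficient of `z^(2p)` in `H` is the sum over tuples on the
right-hand side (`coeff_sinhProdSeries`). Up to a constant `K(z) = z^(-1-2p) H(2πi z)`, so this
coefficient is, up to that constant, the residue of `K` at `0`. The other poles of `K` are simple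
and lie at `η^j m` with `0 ≤ j < n` and `m` a nonzero integer. The residue at `m` is the `m`-th term
of the series over `πi`, and `K(ηz) = η^(-1-2p) K(z)` gives the residue at `η^j m` from it by a
factor `η^(-2pj)`; summed over `j` these factors are `𝒵_{2p+1}`. On the circles `|z| = N + 1/2` the
kernel decays exponentially, because `|sinh (πiv)| ≥ c e^(π |Im v|)` at distance `≥ 1/2` from the
integers and the directions `η^j z` cannot all be nearly real. Hence the residues sum to zero
(`calZ_mul_tsum_sinhTerm`).

*The Barnes zeta-function.* The parameters lie in the closed upper half-plane, and a factor `l` in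
the lower half-plane rotates them into the right one. Then `Γ(s) l^(-s) ζ_n(s)` is the Mellin
transform of `e^(-lau) / ∏ (1 - e^(-l η^j u))` (`hasSum_mellin_barnes`), and since `2a` is the sum
of the `η^j`, this function equals `H(lu) / (η^(n(n-1)/2) (lu)^n)`. Following Riemann, the Mellin
integral is split at `u = 1`: the part over `(1, ∞)` is entire, and the expansion of `H` turns the
part over `(0, 1)` into `∑ c_k / (s + k - n)`, meromorphic on `ℂ` (`exists_isBarnesZeta`). At
`s = n - 2p` the zero of `1 / Γ` leaves only the term with `k = 2p`, which is the same coefficient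
of `H` as before.
-/

section

open Filter Topology MeasureTheory

/-! ### Taylor series at the origin -/

/-- The formal power series `P` is the Taylor expansion of `f` at `0`: it converges to `f` on a
neighbourhood of `0`. -/
def HasTaylorSeries (f : ℂ → ℂ) (P : PowerSeries ℂ) : Prop :=
  ∀ᶠ z in 𝓝 (0 : ℂ), HasSum (fun k : ℕ => PowerSeries.coeff k P * z ^ k) (f z)

namespace HasTaylorSeries

variable {f g : ℂ → ℂ} {P Q : PowerSeries ℂ}

theorem hasFPowerSeriesAt (h : HasTaylorSeries f P) :
    HasFPowerSeriesAt f
      (FormalMultilinearSeries.ofScalars ℂ fun k => PowerSeries.coeff k P) 0 := by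
  rw [hasFPowerSeriesAt_iff]
  filter_upwards [h] with z hz
  simpa [FormalMultilinearSeries.coeff_ofScalars, mul_comm] using hz

theorem unique (hP : HasTaylorSeries f P) (hQ : HasTaylorSeries f Q) : P = Q := by
  have h := hP.hasFPowerSeriesAt.eq_formalMultilinearSeries hQ.hasFPowerSeriesAt
  ext k
  have := congrArg (fun p => FormalMultilinearSeries.coeff p k) h
  simpa [FormalMultilinearSeries.coeff_ofScalars] using this

theorem congr (h : HasTaylorSeries f P) (hfg : f =ᶠ[𝓝 0] g) : HasTaylorSeries g P := by
  filter_upwards [h, hfg] with z hz hz'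
  rwa [← hz']

theorem mul (hf : HasTaylorSeries f P) (hg : HasTaylorSeries g Q) :
    HasTaylorSeries (fun z => f z * g z) (P * Q) := by
  filter_upwards [hf, hg] with z hz hz'
  have h1 := hz.summable.norm
  have h2 := hz'.summable.norm
  have hsum := summable_norm_sum_mul_antidiagonal_of_summable_norm h1 h2
  have heq := tsum_mul_tsum_eq_tsum_sum_antidiagonal_of_summable_norm h1 h2
  rw [hz.tsum_eq, hz'.tsum_eq] at heq
  rw [heq]
  refine hsum.of_norm.hasSum.congr_fun fun k => ?_
  rw [PowerSeries.coeff_mul, Finset.sum_mul]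
  refine Finset.sum_congr rfl fun x hx => ?_
  rw [← Finset.HasAntidiagonal.mem_antidiagonal.mp hx, pow_add]
  ring

theorem one : HasTaylorSeries (fun _ => 1) 1 := by
  refine Eventually.of_forall fun z => ?_
  convert hasSum_ite_eq (0 : ℕ) (1 : ℂ) using 2 with k
  by_cases hk : k = 0 <;> simp [hk, PowerSeries.coeff_one]

theorem prod {ι : Type*} (s : Finset ι) {f : ι → ℂ → ℂ} {P : ι → PowerSeries ℂ}
    (h : ∀ i ∈ s, HasTaylorSeries (f i) (P i)) :
    HasTaylorSeries (fun z => ∏ i ∈ s, f i z) (∏ i ∈ s, P i) := by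
  classical
  induction s using Finset.induction_on with
  | empty => simpa using one
  | insert a s ha ih =>
    simp only [Finset.prod_insert ha]
    exact (h a (Finset.mem_insert_self a s)).mul
      (ih fun i hi => h i (Finset.mem_insert_of_mem hi))

theorem comp_mul_left (h : HasTaylorSeries f P) (c : ℂ) :
    HasTaylorSeries (fun z => f (c * z)) (PowerSeries.rescale c P) := by
  have ht : Tendsto (fun z : ℂ => c * z) (𝓝 0) (𝓝 0) := by
    have : Continuous fun z : ℂ => c * z := by fun_prop
    simpa using this.tendsto 0
  filter_upwards [ht.eventually h] with z hz
  convert hz using 2 with k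
  rw [PowerSeries.coeff_rescale, mul_pow]
  ring

/-- Truncating the Taylor series after the terms of degree `< K` leaves an error `O(z ^ K)`. -/
theorem isBigO_sub_sum (h : HasTaylorSeries f P) (K : ℕ) :
    (fun z => f z - ∑ k ∈ Finset.range K, PowerSeries.coeff k P * z ^ k) =O[𝓝 0]
      fun z => z ^ K := by
  have := h.hasFPowerSeriesAt.isBigO_sub_partialSum_pow K
  refine (this.congr (fun z => ?_) fun z => rfl).trans
    (Asymptotics.IsBigO.of_bound 1 (Eventually.of_forall fun z => by simp))
  simp [FormalMultilinearSeries.partialSum, mul_comm]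

end HasTaylorSeries

theorem AnalyticAt.exists_hasTaylorSeries {f : ℂ → ℂ} (h : AnalyticAt ℂ f 0) :
    ∃ P, HasTaylorSeries f P := by
  obtain ⟨p, hp⟩ := h
  rw [hasFPowerSeriesAt_iff] at hp
  refine ⟨PowerSeries.mk fun k => p.coeff k, ?_⟩
  filter_upwards [hp] with z hz
  simpa [mul_comm] using hz

theorem hasTaylorSeries_exp : HasTaylorSeries Complex.exp (PowerSeries.exp ℂ) := by
  refine Eventually.of_forall fun z => ?_
  rw [Complex.exp_eq_exp_ℂ]
  refine (NormedSpace.expSeries_div_hasSum_exp z).congr_fun fun k => ?_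
  simp [PowerSeries.coeff_exp, div_eq_inv_mul]

theorem hasTaylorSeries_id : HasTaylorSeries (fun z => z) PowerSeries.X := by
  refine Eventually.of_forall fun z => ?_
  convert hasSum_ite_eq (1 : ℕ) z using 2 with k
  by_cases hk : k = 1 <;> simp [hk, PowerSeries.coeff_X]

theorem hasTaylorSeries_exp_sub_one :
    HasTaylorSeries (fun z => Complex.exp z - 1) (PowerSeries.exp ℂ - 1) := by
  filter_upwards [hasTaylorSeries_exp, HasTaylorSeries.one] with z h1 h2
  simpa [sub_mul] using h1.sub h2

/-! ### The generating function of `B_k(1/2)` -/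

/-- The function `(z / 2) / sinh (z / 2)`, with its limit `1` filled in at `z = 0`. -/
noncomputable def halfDivSinh (z : ℂ) : ℂ :=
  if z = 0 then 1 else z / 2 / Complex.sinh (z / 2)

/-- The exponential generating series of the numbers `B_k(1/2)`. -/
noncomputable def bernoulliHalfSeries : PowerSeries ℂ :=
  PowerSeries.mk fun k => bernoulliHalf k / (k.factorial : ℂ)

theorem two_mul_exp_mul_sinh (z : ℂ) :
    2 * Complex.exp (z / 2) * Complex.sinh (z / 2) = Complex.exp z - 1 := by
  rw [Complex.sinh]
  have h1 : Complex.exp z = Complex.exp (z / 2) * Complex.exp (z / 2) := by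
    rw [← Complex.exp_add]; ring_nf
  have h2 : Complex.exp (z / 2) * Complex.exp (-(z / 2)) = 1 := by
    rw [← Complex.exp_add]; simp
  rw [h1]
  linear_combination -h2

theorem halfDivSinh_eq_dslope (z : ℂ) :
    halfDivSinh z = Complex.exp (z / 2) * (dslope Complex.exp 0 z)⁻¹ := by
  rw [halfDivSinh]
  split_ifs with hz
  · subst hz; simp [dslope_same]
  · rw [dslope_of_ne _ hz, slope_def_field, Complex.exp_zero, ← two_mul_exp_mul_sinh, sub_zero,
      inv_div]
    have := Complex.exp_ne_zero (z / 2)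
    by_cases hs : Complex.sinh (z / 2) = 0
    · simp [hs]
    · field_simp

theorem analyticAt_halfDivSinh : AnalyticAt ℂ halfDivSinh 0 := by
  have hd : AnalyticAt ℂ (dslope Complex.exp 0) 0 := by
    have : DifferentiableOn ℂ (dslope Complex.exp 0) Set.univ :=
      (Complex.differentiableOn_dslope Filter.univ_mem).mpr
        Complex.differentiable_exp.differentiableOn
    exact this.analyticAt Filter.univ_mem
  rw [funext halfDivSinh_eq_dslope]
  refine AnalyticAt.mul (by fun_prop) (hd.inv ?_)
  simp [dslope_same]

theorem bernoulliHalfSeries_mul :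
    bernoulliHalfSeries * (PowerSeries.exp ℂ - 1) =
      PowerSeries.X * PowerSeries.rescale (1 / 2 : ℂ) (PowerSeries.exp ℂ) := by
  rw [← Polynomial.bernoulli_generating_function]
  congr 1
  ext k
  have h : (1 / 2 : ℂ) = algebraMap ℚ ℂ (1 / 2) := by simp
  simp only [bernoulliHalfSeries, PowerSeries.coeff_mk, bernoulliHalf]
  rw [h, Polynomial.aeval_algebraMap_apply]
  simp [div_eq_inv_mul]

/-- The generating function of the `B_k(1/2)`: the Taylor series of `(z / 2) / sinh (z / 2)`. -/
theorem hasTaylorSeries_halfDivSinh : HasTaylorSeries halfDivSinh bernoulliHalfSeries := by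
  obtain ⟨P, hP⟩ := analyticAt_halfDivSinh.exists_hasTaylorSeries
  have h1 := hP.mul hasTaylorSeries_exp_sub_one
  have h2 := hasTaylorSeries_id.mul (hasTaylorSeries_exp.comp_mul_left (1 / 2))
  have hev : (fun z => halfDivSinh z * (Complex.exp z - 1)) =ᶠ[𝓝 0]
      fun z => z * Complex.exp (1 / 2 * z) := by
    filter_upwards [Metric.ball_mem_nhds (0 : ℂ) (show (0 : ℝ) < 1 by norm_num)] with z hz
    rcases eq_or_ne z 0 with rfl | hz0
    · simp
    have hs : Complex.sinh (z / 2) ≠ 0 := by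
      intro hs
      have hexp : Complex.exp z = 1 := by
        have := two_mul_exp_mul_sinh z
        rw [hs, mul_zero] at this
        exact (sub_eq_zero.mp this.symm)
      obtain ⟨k, hk⟩ := Complex.exp_eq_one_iff.mp hexp
      have hnorm : ‖z‖ = |(k : ℝ)| * (2 * Real.pi) := by
        rw [hk]; simp [abs_of_pos Real.pi_pos]
      have hk0 : k ≠ 0 := by rintro rfl; simp at hk; exact hz0 hk
      have hk1 : (1 : ℝ) ≤ |(k : ℝ)| := by exact_mod_cast Int.one_le_abs hk0
      have hz1 : ‖z‖ < 1 := by simpa using hz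
      nlinarith [Real.pi_gt_three]
    rw [halfDivSinh, if_neg hz0, ← two_mul_exp_mul_sinh, show 1 / 2 * z = z / 2 by ring]
    field_simp
  have h3 := (h1.congr hev).unique h2
  rw [← bernoulliHalfSeries_mul] at h3
  have hne : PowerSeries.exp ℂ - 1 ≠ 0 := by
    intro h
    have := congrArg (PowerSeries.coeff 1) h
    simp [PowerSeries.coeff_exp, PowerSeries.coeff_one] at this
  rwa [mul_right_cancel₀ hne h3] at hP

theorem bernoulliHalf_of_odd {k : ℕ} (hk : Odd k) : bernoulliHalf k = 0 := by
  have h := Polynomial.bernoulli_eval_one_sub k (1 / 2)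
  rw [hk.neg_one_pow, show (1 : ℚ) - 1 / 2 = 1 / 2 by norm_num] at h
  have h0 : Polynomial.eval (1 / 2 : ℚ) (Polynomial.bernoulli k) = 0 := by linarith
  rw [bernoulliHalf, h0, Rat.cast_zero]

/-- The Taylor series of `∏_{j<n} (η^j z / 2) / sinh (η^j z / 2)`. -/
noncomputable def sinhProdSeries (n : ℕ) : PowerSeries ℂ :=
  ∏ j : Fin n, PowerSeries.rescale (etaRoot n ^ (j : ℕ)) bernoulliHalfSeries

theorem hasTaylorSeries_prod_halfDivSinh (n : ℕ) :
    HasTaylorSeries (fun z => ∏ j : Fin n, halfDivSinh (etaRoot n ^ (j : ℕ) * z))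
      (sinhProdSeries n) :=
  HasTaylorSeries.prod _ fun _ _ => hasTaylorSeries_halfDivSinh.comp_mul_left _

/-- The coefficient of `z ^ (2p)` only involves tuples of even exponents, as `B_k(1/2) = 0` for odd
`k`; halving these exponents gives the tuples with sum `p`. -/
theorem coeff_sinhProdSeries (n p : ℕ) :
    PowerSeries.coeff (2 * p) (sinhProdSeries n) =
      ∑ m ∈ tuplesWithSum n p, ∏ ν : Fin n,
          bernoulliHalf (2 * m ν) / ((2 * m ν).factorial : ℂ) *
            etaRoot n ^ (2 * (ν : ℕ) * m ν) := by
  classical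
  rw [sinhProdSeries, PowerSeries.coeff_prod]
  symm
  refine Finset.sum_of_injOn (fun m => Finsupp.equivFunOnFinite.symm fun ν => 2 * m ν)
    ?_ ?_ ?_ ?_
  · intro m _ m' _ h
    funext ν
    have := DFunLike.congr_fun h ν
    simpa using this
  · intro m hm
    have hm := (mem_tuplesWithSum n p m).mp hm
    simp only [Finset.mem_coe, Finset.mem_finsuppAntidiag]
    refine ⟨?_, Finset.subset_univ _⟩
    simp only [Finsupp.equivFunOnFinite_symm_apply_apply, ← Finset.mul_sum]
    norm_cast at hm
    rw [hm]
  · intro l hl hl'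
    obtain ⟨ν, hν⟩ : ∃ ν, Odd (l ν) := by
      by_contra! hcon
      simp only [Nat.not_odd_iff_even] at hcon
      refine hl' ⟨fun ν => l ν / 2, ?_, ?_⟩
      · refine (mem_tuplesWithSum n p _).mpr ?_
        have h1 := (Finset.mem_finsuppAntidiag.mp hl).1
        have h2 : 2 * ∑ ν, l ν / 2 = ∑ ν, l ν := by
          rw [Finset.mul_sum]
          exact Finset.sum_congr rfl fun ν _ => Nat.two_mul_div_two_of_even (hcon ν)
        have h3 : ∑ ν, l ν = 2 * p := h1
        norm_cast
        omega
      · ext ν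
        simpa using Nat.two_mul_div_two_of_even (hcon ν)
    refine Finset.prod_eq_zero (Finset.mem_univ ν) ?_
    simp [PowerSeries.coeff_rescale, bernoulliHalfSeries, bernoulliHalf_of_odd hν]
  · intro m _
    refine Finset.prod_congr rfl fun ν _ => ?_
    simp only [Finsupp.equivFunOnFinite_symm_apply_apply, PowerSeries.coeff_rescale,
      bernoulliHalfSeries, PowerSeries.coeff_mk, ← pow_mul]
    rw [show (ν : ℕ) * (2 * m ν) = 2 * (ν : ℕ) * m ν by ring]
    ring

/-! ### Lower bounds for the hyperbolic sine -/

theorem sinh_abs_re_le_norm_sinh (w : ℂ) : Real.sinh |w.re| ≤ ‖Complex.sinh w‖ := by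
  have h1 : ‖Complex.exp w‖ - ‖Complex.exp (-w)‖ ≤ ‖Complex.exp w - Complex.exp (-w)‖ :=
    norm_sub_norm_le _ _
  have h2 : ‖Complex.exp (-w)‖ - ‖Complex.exp w‖ ≤ ‖Complex.exp w - Complex.exp (-w)‖ := by
    rw [norm_sub_rev (Complex.exp w)]
    exact norm_sub_norm_le _ _
  have h3 : ‖Complex.sinh w‖ = ‖Complex.exp w - Complex.exp (-w)‖ / 2 := by
    rw [Complex.sinh, norm_div]; simp
  simp only [Complex.norm_exp, Complex.neg_re] at h1 h2
  rw [h3, Real.sinh_eq]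
  rcases abs_cases w.re with ⟨h, _⟩ | ⟨h, _⟩ <;> rw [h] <;> try rw [neg_neg]
  all_goals linarith

theorem Real.exists_mul_exp_le_sinh {x₀ : ℝ} (hx₀ : 0 < x₀) :
    ∃ c > 0, ∀ x ≥ x₀, c * Real.exp x ≤ Real.sinh x := by
  refine ⟨(1 - Real.exp (-(2 * x₀))) / 2, ?_, fun x hx => ?_⟩
  · have : Real.exp (-(2 * x₀)) < 1 := by rw [Real.exp_lt_one_iff]; linarith
    linarith
  · have h1 : Real.exp (-(2 * x)) ≤ Real.exp (-(2 * x₀)) := by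
      rw [Real.exp_le_exp]; linarith
    have h2 : Real.exp (-x) = Real.exp (-(2 * x)) * Real.exp x := by
      rw [← Real.exp_add]; ring_nf
    rw [Real.sinh_eq, h2]
    nlinarith [Real.exp_pos x]

theorem norm_sinh_sq (w : ℂ) :
    ‖Complex.sinh w‖ ^ 2 = Real.sinh w.re ^ 2 + Real.sin w.im ^ 2 := by
  have h : Complex.sinh w = (Real.sinh w.re * Real.cos w.im : ℝ) +
      (Real.cosh w.re * Real.sin w.im : ℝ) * Complex.I := by
    conv_lhs => rw [← Complex.re_add_im w, Complex.sinh_add, Complex.cosh_mul_I, Complex.sinh_mul_I]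
    push_cast
    ring
  rw [h, ← Complex.normSq_eq_norm_sq, Complex.normSq_add_mul_I, mul_pow, mul_pow, Real.cos_sq',
    Real.cosh_sq]
  ring

theorem abs_sin_pi_mul_sub_intCast (x : ℝ) (m : ℤ) :
    |Real.sin (Real.pi * (x - m))| = |Real.sin (Real.pi * x)| := by
  rw [mul_sub, mul_comm Real.pi (m : ℝ), Real.sin_sub_int_mul_pi, abs_mul, abs_zpow]
  simp

/-- Away from its zeros, the integers, `v ↦ sinh (πiv)` is bounded below by a multiple of
`exp (π |Im v|)`. -/
theorem exists_mul_exp_le_norm_sinh :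
    ∃ c > 0, ∀ v : ℂ, (∀ m : ℤ, 1 / 2 ≤ ‖v - m‖) →
      c * Real.exp (Real.pi * |v.im|) ≤ ‖Complex.sinh (Real.pi * Complex.I * v)‖ := by
  obtain ⟨c, hc, hcs⟩ := Real.exists_mul_exp_le_sinh (x₀ := Real.pi / 4) (by positivity)
  refine ⟨min c (4 / 5 * Real.exp (-(Real.pi / 4))), by positivity, fun v hv => ?_⟩
  have hre : (Real.pi * Complex.I * v).re = -(Real.pi * v.im) := by simp
  have him : (Real.pi * Complex.I * v).im = Real.pi * v.re := by simp
  have hE := Real.exp_pos (Real.pi * |v.im|)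
  rcases le_total (1 / 4) |v.im| with h | h
  · have h1 := sinh_abs_re_le_norm_sinh (Real.pi * Complex.I * v)
    rw [hre, abs_neg, abs_mul, abs_of_pos Real.pi_pos] at h1
    have h2 := hcs (Real.pi * |v.im|) (by nlinarith [Real.pi_pos])
    have h3 := mul_le_mul_of_nonneg_right (min_le_left c (4 / 5 * Real.exp (-(Real.pi / 4)))) hE.le
    linarith
  · have h1 : |Real.sin (Real.pi * v.re)| ≤ ‖Complex.sinh (Real.pi * Complex.I * v)‖ := by
      refine abs_le_of_sq_le_sq ?_ (norm_nonneg _)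
      rw [norm_sinh_sq, him]
      nlinarith [sq_nonneg (Real.sinh (Real.pi * Complex.I * v).re)]
    -- the distance from `Re v` to the nearest integer is at least `√3 / 4 > 2 / 5`
    set m := round v.re with hm
    have h2 : |v.re - m| ≤ 1 / 2 := abs_sub_round v.re
    have h3 : 2 / 5 ≤ |v.re - m| := by
      have h4 : (1 / 2) ^ 2 ≤ ‖v - m‖ ^ 2 := by
        have := hv m
        gcongr
      rw [← Complex.normSq_eq_norm_sq, Complex.normSq_apply] at h4
      simp only [Complex.sub_re, Complex.intCast_re, Complex.sub_im, Complex.intCast_im,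
        sub_zero] at h4
      have h5 := abs_nonneg (v.re - m)
      have h6 := abs_nonneg v.im
      rw [← abs_mul_abs_self (v.re - m), ← abs_mul_abs_self v.im] at h4
      nlinarith
    have h4 : 2 / Real.pi * |Real.pi * (v.re - m)| ≤ |Real.sin (Real.pi * (v.re - m))| := by
      refine Real.mul_abs_le_abs_sin ?_
      rw [abs_mul, abs_of_pos Real.pi_pos]
      nlinarith [Real.pi_pos]
    rw [abs_sin_pi_mul_sub_intCast, abs_mul, abs_of_pos Real.pi_pos, ← mul_assoc,
      div_mul_cancel₀ _ Real.pi_pos.ne'] at h4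
    have h5 : Real.exp (-(Real.pi / 4)) * Real.exp (Real.pi * |v.im|) ≤ 1 := by
      rw [← Real.exp_add, Real.exp_le_one_iff]
      nlinarith [Real.pi_pos]
    have h6 := mul_le_mul_of_nonneg_right (min_le_right c (4 / 5 * Real.exp (-(Real.pi / 4)))) hE.le
    nlinarith

theorem sinh_pi_I_mul_eq_zero_iff (v : ℂ) :
    Complex.sinh (Real.pi * Complex.I * v) = 0 ↔ ∃ m : ℤ, v = m := by
  rw [show (Real.pi : ℂ) * Complex.I * v = (Real.pi * v) * Complex.I by ring, Complex.sinh_mul_I,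
    mul_eq_zero, or_iff_left Complex.I_ne_zero, Complex.sin_eq_zero_iff]
  have hpi : (Real.pi : ℂ) ≠ 0 := by exact_mod_cast Real.pi_ne_zero
  refine exists_congr fun m => ⟨fun h => mul_left_cancel₀ hpi (by rw [h]; ring), ?_⟩
  rintro rfl
  ring

/-! ### The residue theorem for simple poles -/

/-- Finitely many removable singularities can be removed at once. -/
theorem exists_differentiableAt_of_tendsto_zero {f : ℂ → ℂ} {U S : Set ℂ} (hS : S.Finite)
    (hU : ∀ a ∈ S, U ∈ 𝓝 a) (hf : ∀ z ∈ U, z ∉ S → DifferentiableAt ℂ f z)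
    (hlim : ∀ a ∈ S, Tendsto (fun z => (z - a) * f z) (𝓝[≠] a) (𝓝 0)) :
    ∃ g : ℂ → ℂ, (∀ z ∉ S, g z = f z) ∧ ∀ z ∈ U, DifferentiableAt ℂ g z := by
  classical
  refine ⟨fun z => if z ∈ S then limUnder (𝓝[≠] z) f else f z, fun z hz => if_neg hz,
    fun z hz => ?_⟩
  by_cases hzS : z ∈ S
  · have hopen : (S \ {z})ᶜ ∈ 𝓝 z :=
      ((hS.subset Set.sdiff_subset).isClosed.isOpen_compl).mem_nhds (by simp)
    have hV : U ∩ (S \ {z})ᶜ ∈ 𝓝 z := inter_mem (hU z hzS) hopen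
    have hd := Complex.differentiableOn_update_limUnder_of_isLittleO (f := f) hV
      (fun w hw => (hf w hw.1.1 fun hwS => hw.1.2 ⟨hwS, hw.2⟩).differentiableWithinAt) ?_
    · refine (hd.differentiableAt hV).congr_of_eventuallyEq ?_
      filter_upwards [hopen] with w hw
      rcases eq_or_ne w z with rfl | hwz
      · simp [hzS]
      · have : w ∉ S := fun h => hw ⟨h, hwz⟩
        simp [this, hwz]
    · rw [Asymptotics.isLittleO_iff_tendsto']
      · have h1 : Tendsto (fun w : ℂ => (w - z) * f z) (𝓝[≠] z) (𝓝 0) := by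
          have : Continuous fun w : ℂ => (w - z) * f z := by fun_prop
          simpa using this.tendsto z |>.mono_left nhdsWithin_le_nhds
        have h2 := (hlim z hzS).sub h1
        rw [sub_zero] at h2
        refine h2.congr fun w => ?_
        rw [div_inv_eq_mul]
        ring
      · filter_upwards [self_mem_nhdsWithin] with w hw h0
        exact absurd (sub_eq_zero.mp (inv_eq_zero.mp h0)) hw
  · refine (hf z hz hzS).congr_of_eventuallyEq ?_
    filter_upwards [hS.isClosed.isOpen_compl.mem_nhds hzS] with w hw
    exact if_neg hw

/-- The residue theorem on a disc, for a function with finitely many poles, all simple. -/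
theorem circleIntegral_eq_sum_residues {ι : Type*} [DecidableEq ι] (s : Finset ι) {a r : ι → ℂ}
    {f : ℂ → ℂ} {R : ℝ} (hR : 0 < R) (hinj : Set.InjOn a s)
    (ha : ∀ i ∈ s, a i ∈ Metric.ball (0 : ℂ) R)
    (hf : ∀ z ∈ Metric.closedBall (0 : ℂ) R, (∀ i ∈ s, z ≠ a i) → DifferentiableAt ℂ f z)
    (hr : ∀ i ∈ s, Tendsto (fun z => (z - a i) * f z) (𝓝[≠] a i) (𝓝 (r i))) :
    (∮ z in C(0, R), f z) = 2 * Real.pi * Complex.I * ∑ i ∈ s, r i := by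
  have hne : ∀ z ∈ Metric.sphere (0 : ℂ) R, ∀ i ∈ s, z ≠ a i := by
    rintro z hz i hi rfl
    have h1 := ha i hi
    rw [mem_ball_zero_iff] at h1
    rw [mem_sphere_zero_iff_norm] at hz
    exact h1.ne hz
  obtain ⟨g, hg, hgd⟩ := exists_differentiableAt_of_tendsto_zero
    (f := fun z => f z - ∑ i ∈ s, r i * (z - a i)⁻¹) (U := Metric.closedBall (0 : ℂ) R)
    (S := a '' s) (s.finite_toSet.image a)
    (by
      rintro _ ⟨i, hi, rfl⟩
      exact mem_of_superset (Metric.isOpen_ball.mem_nhds (ha i hi)) Metric.ball_subset_closedBall)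
    (by
      intro z hz hzS
      have hz' : ∀ i ∈ s, z ≠ a i := fun i hi h => hzS ⟨i, hi, h.symm⟩
      refine (hf z hz hz').sub (DifferentiableAt.fun_sum fun i hi => ?_)
      have := sub_ne_zero.mpr (hz' i hi)
      fun_prop (disch := assumption))
    (by
      rintro _ ⟨i, hi, rfl⟩
      have h1 : Tendsto (fun z => ∑ k ∈ s, (z - a i) * (r k * (z - a k)⁻¹)) (𝓝[≠] a i)
          (𝓝 (∑ k ∈ s, if k = i then r i else 0)) := by
        refine tendsto_finsetSum _ fun k hk => ?_
        split_ifs with hki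
        · subst hki
          refine tendsto_const_nhds.congr' ?_
          filter_upwards [self_mem_nhdsWithin] with z hz
          have : z - a k ≠ 0 := sub_ne_zero.mpr hz
          field_simp
        · have hka : a i - a k ≠ 0 :=
            sub_ne_zero.mpr fun h => hki (hinj hk hi h.symm)
          have hc : ContinuousAt (fun z => (z - a i) * (r k * (z - a k)⁻¹)) (a i) := by
            fun_prop (disch := assumption)
          simpa using hc.tendsto.mono_left nhdsWithin_le_nhds
      rw [Finset.sum_ite_eq' s i, if_pos (Finset.mem_coe.mp hi)] at h1
      have h2 := (hr i hi).sub h1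
      rw [sub_self] at h2
      refine h2.congr fun z => ?_
      rw [mul_sub, Finset.mul_sum])
  have h0 : (∮ z in C(0, R), g z) = 0 :=
    Complex.circleIntegral_eq_zero_of_differentiable_on_off_countable hR.le Set.countable_empty
      (fun z hz => (hgd z hz).continuousAt.continuousWithinAt)
      fun z hz => hgd z (Metric.ball_subset_closedBall hz.1)
  have hcongr : (∮ z in C(0, R), g z) =
      ∮ z in C(0, R), (f z - ∑ i ∈ s, r i * (z - a i)⁻¹) :=
    circleIntegral.integral_congr hR.le fun z hz =>
      hg z (by rintro ⟨i, hi, h⟩; exact hne z hz i hi h.symm)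
  have hint : ∀ i ∈ s, CircleIntegrable (fun z => r i * (z - a i)⁻¹) 0 R := fun i hi =>
    ContinuousOn.circleIntegrable hR.le (continuousOn_const.mul
      ((continuousOn_id.sub continuousOn_const).inv₀ fun z hz =>
        sub_ne_zero.mpr (hne z hz i hi)))
  have hfint : CircleIntegrable f 0 R := ContinuousOn.circleIntegrable hR.le fun z hz =>
    (hf z (Metric.sphere_subset_closedBall hz) (hne z hz)).continuousAt.continuousWithinAt
  have hsint : CircleIntegrable (fun z => ∑ i ∈ s, r i * (z - a i)⁻¹) 0 R :=
    CircleIntegrable.fun_sum s hint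
  rw [h0, circleIntegral.integral_sub hfint hsint, circleIntegral.integral_fun_sum hint,
    eq_comm, sub_eq_zero] at hcongr
  rw [hcongr, Finset.mul_sum]
  refine Finset.sum_congr rfl fun i hi => ?_
  rw [circleIntegral.integral_const_mul, circleIntegral.integral_sub_inv_of_mem_ball (ha i hi)]
  ring

/-! ### The root of unity `η` -/

theorem Complex.im_mul_intCast (w : ℂ) (m : ℤ) : (w * m).im = w.im * m := by simp

theorem etaRoot_pow (n j : ℕ) :
    etaRoot n ^ j = Complex.exp ((Real.pi * j / n : ℝ) * Complex.I) := by
  rw [etaRoot, ← Complex.exp_nat_mul]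
  congr 1
  push_cast
  ring

theorem etaRoot_ne_zero (n : ℕ) : etaRoot n ≠ 0 := Complex.exp_ne_zero _

theorem etaRoot_pow_self {n : ℕ} (hn : n ≠ 0) : etaRoot n ^ n = -1 := by
  have : (n : ℝ) ≠ 0 := by exact_mod_cast hn
  rw [etaRoot_pow, mul_div_assoc, div_self this, mul_one, Complex.exp_pi_mul_I]

theorem norm_etaRoot_pow (n j : ℕ) : ‖etaRoot n ^ j‖ = 1 := by
  rw [etaRoot_pow, Complex.norm_exp_ofReal_mul_I]

theorem im_etaRoot_pow (n j : ℕ) : (etaRoot n ^ j).im = Real.sin (Real.pi * j / n) := by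
  rw [etaRoot_pow, Complex.exp_ofReal_mul_I_im]

theorem im_etaRoot_pow_pos {n j : ℕ} (hj : 0 < j) (hjn : j < n) : 0 < (etaRoot n ^ j).im := by
  have hn : (0 : ℝ) < n := by exact_mod_cast hj.trans hjn
  have hj' : (0 : ℝ) < j := by exact_mod_cast hj
  have hjn' : (j : ℝ) < n := by exact_mod_cast hjn
  rw [im_etaRoot_pow]
  refine Real.sin_pos_of_pos_of_lt_pi (by positivity) ?_
  rw [div_lt_iff₀ hn]
  exact mul_lt_mul_of_pos_left hjn' Real.pi_pos

/-- The points `η^j m` with `0 ≤ j < n` and `m` a nonzero integer are pairwise distinct. -/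
theorem eq_of_etaRoot_pow_mul_eq {n j k : ℕ} {m l : ℤ} (hj : j < n) (hk : k < n) (hm : m ≠ 0)
    (hl : l ≠ 0) (h : etaRoot n ^ j * m = etaRoot n ^ k * l) : j = k ∧ m = l := by
  wlog hjk : j ≤ k generalizing j k m l
  · exact (this hk hj hl hm h.symm (le_of_not_ge hjk)).imp Eq.symm Eq.symm
  obtain ⟨d, rfl⟩ := Nat.exists_eq_add_of_le hjk
  have h1 : (m : ℂ) = etaRoot n ^ d * l := by
    refine mul_left_cancel₀ (pow_ne_zero j (etaRoot_ne_zero n)) ?_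
    rw [h, pow_add]
    ring
  have hd : d = 0 := by
    by_contra hd
    have h2 := congrArg Complex.im h1
    have h3 := im_etaRoot_pow_pos (n := n) (Nat.pos_of_ne_zero hd) (by omega)
    rw [Complex.im_mul_intCast, Complex.intCast_im, eq_comm, mul_eq_zero] at h2
    rcases h2 with h2 | h2
    · exact h3.ne' h2
    · exact hl (by exact_mod_cast h2)
  subst hd
  exact ⟨by simp, by exact_mod_cast (by simpa using h1 : (m : ℂ) = l)⟩

theorem exists_eq_etaRoot_pow_mul {n j : ℕ} (hj : j < n) {z : ℂ} {m : ℤ}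
    (h : etaRoot n ^ j * z = m) : ∃ k < n, ∃ l : ℤ, z = etaRoot n ^ k * l := by
  rcases Nat.eq_zero_or_pos j with rfl | hj0
  · exact ⟨0, hj, m, by simpa using h⟩
  · refine ⟨n - j, by omega, -m, ?_⟩
    refine mul_left_cancel₀ (pow_ne_zero j (etaRoot_ne_zero n)) ?_
    rw [h, ← mul_assoc, ← pow_add, Nat.add_sub_of_le hj.le, etaRoot_pow_self (by omega)]
    simp

/-! ### The kernel `z^(n-1-2p) / ∏ sinh (πi η^j z)` -/

/-- The meromorphic function `z^(n-1-2p) / ∏_{j<n} sinh (πi η^j z)`, whose residues at the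
nonzero integers `m` are the terms `sinhTerm n p m`, divided by `πi`. -/
noncomputable def sinhKernel (n : ℕ) (p : ℤ) (z : ℂ) : ℂ :=
  z ^ ((n : ℤ) - 1 - 2 * p) /
    ∏ j ∈ Finset.range n, Complex.sinh (Real.pi * Complex.I * (etaRoot n ^ j * z))

theorem sinhKernel_etaRoot_mul {n : ℕ} (hn : n ≠ 0) (p : ℤ) (z : ℂ) :
    sinhKernel n p (etaRoot n * z) = etaRoot n ^ (-1 - 2 * p) * sinhKernel n p z := by
  obtain ⟨k, rfl⟩ := Nat.exists_eq_succ_of_ne_zero hn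
  have hprod : ∏ j ∈ Finset.range (k + 1),
        Complex.sinh (Real.pi * Complex.I * (etaRoot (k + 1) ^ j * (etaRoot (k + 1) * z))) =
      -∏ j ∈ Finset.range (k + 1),
        Complex.sinh (Real.pi * Complex.I * (etaRoot (k + 1) ^ j * z)) := by
    rw [Finset.prod_range_succ, Finset.prod_range_succ', ← mul_neg]
    congr 1
    · refine Finset.prod_congr rfl fun j _ => ?_
      rw [pow_succ]
      ring_nf
    · rw [← mul_assoc (etaRoot (k + 1) ^ k), ← pow_succ, etaRoot_pow_self hn, ← Complex.sinh_neg]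
      simp
  have hpow : etaRoot (k + 1) ^ (((k + 1 : ℕ) : ℤ) - 1 - 2 * p) =
      -etaRoot (k + 1) ^ (-1 - 2 * p) := by
    rw [show ((k + 1 : ℕ) : ℤ) - 1 - 2 * p = ((k + 1 : ℕ) : ℤ) + (-1 - 2 * p) by ring,
      zpow_add₀ (etaRoot_ne_zero _), zpow_natCast, etaRoot_pow_self hn]
    ring
  simp only [Nat.succ_eq_add_one, sinhKernel, hprod, mul_zpow, hpow]
  rw [div_neg, neg_mul, neg_div, neg_neg, mul_div_assoc]

theorem sinhKernel_etaRoot_pow_mul {n : ℕ} (hn : n ≠ 0) (p : ℤ) (j : ℕ) (z : ℂ) :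
    sinhKernel n p (etaRoot n ^ j * z) =
      etaRoot n ^ ((j : ℤ) * (-1 - 2 * p)) * sinhKernel n p z := by
  induction j with
  | zero => simp
  | succ j ih =>
    rw [pow_succ', mul_assoc, sinhKernel_etaRoot_mul hn, ih, ← mul_assoc,
      ← zpow_add₀ (etaRoot_ne_zero n)]
    congr 2
    push_cast
    ring

theorem prod_range_eq_mul_prod_Icc {n : ℕ} (hn : n ≠ 0) (f : ℕ → ℂ) :
    ∏ j ∈ Finset.range n, f j = f 0 * ∏ j ∈ Finset.Icc 1 (n - 1), f j := by
  rw [Finset.range_eq_Ico, Finset.prod_eq_prod_Ico_succ_bot (Nat.pos_of_ne_zero hn)]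
  congr 1

theorem differentiableAt_sinhKernel {n : ℕ} (p : ℤ) {z : ℂ} (hz : z ≠ 0)
    (h : ∀ k < n, ∀ l : ℤ, z ≠ etaRoot n ^ k * l) :
    DifferentiableAt ℂ (sinhKernel n p) z := by
  refine (differentiableAt_zpow.mpr (Or.inl hz)).div (by fun_prop) ?_
  refine Finset.prod_ne_zero_iff.mpr fun j hj h0 => ?_
  obtain ⟨m, hm⟩ := (sinh_pi_I_mul_eq_zero_iff _).mp h0
  obtain ⟨k, hk, l, hl⟩ := exists_eq_etaRoot_pow_mul (Finset.mem_range.mp hj) hm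
  exact h k hk l hl

theorem sinh_pi_I_mul_ne_zero {n j : ℕ} (hj : 0 < j) (hjn : j < n) {m : ℤ} (hm : m ≠ 0) :
    Complex.sinh (Real.pi * Complex.I * (etaRoot n ^ j * m)) ≠ 0 := by
  intro h
  obtain ⟨l, hl⟩ := (sinh_pi_I_mul_eq_zero_iff _).mp h
  have h2 := congrArg Complex.im hl
  rw [Complex.im_mul_intCast, Complex.intCast_im, mul_eq_zero] at h2
  exact h2.elim (im_etaRoot_pow_pos hj hjn).ne' fun h => hm (by exact_mod_cast h)

theorem sinhTerm_eq (n : ℕ) (p m : ℤ) :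
    sinhTerm n p m = (-1) ^ m * ((m : ℂ) ^ ((n : ℤ) - 1 - 2 * p) /
      ∏ j ∈ Finset.Icc 1 (n - 1), Complex.sinh (Real.pi * Complex.I * (etaRoot n ^ j * m))) := by
  have h1 : ∀ j, Complex.sinh (m * Real.pi * Complex.I * etaRoot n ^ j) =
      Complex.sinh (Real.pi * Complex.I * (etaRoot n ^ j * m)) := fun j => by ring_nf
  simp only [sinhTerm, h1]
  rw [show 2 * p + 1 - (n : ℤ) = -((n : ℤ) - 1 - 2 * p) by ring, zpow_neg, ← div_eq_mul_inv,
    div_div_eq_mul_div, mul_div_assoc]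

theorem sinhTerm_zero {n : ℕ} (hn : 2 ≤ n) (p : ℤ) : sinhTerm n p 0 = 0 := by
  rw [sinhTerm, Finset.prod_eq_zero (i := 1) (by simp; omega) (by simp)]
  simp

theorem cosh_pi_I_mul_int (m : ℤ) : Complex.cosh (Real.pi * Complex.I * m) = (-1) ^ m := by
  rw [show (Real.pi : ℂ) * Complex.I * m = (Real.pi * m) * Complex.I by ring, Complex.cosh_mul_I,
    mul_comm, ← Complex.ofReal_intCast, ← Complex.ofReal_mul, ← Complex.ofReal_cos,
    Real.cos_int_mul_pi]
  simp

theorem tendsto_residue_sinhKernel_int {n : ℕ} (hn : n ≠ 0) (p : ℤ) {m : ℤ} (hm : m ≠ 0) :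
    Tendsto (fun z => (z - m) * sinhKernel n p z) (𝓝[≠] (m : ℂ))
      (𝓝 (sinhTerm n p m / (Real.pi * Complex.I))) := by
  have hpi : (Real.pi : ℂ) ≠ 0 := by exact_mod_cast Real.pi_ne_zero
  have hd : HasDerivAt (fun z : ℂ => Complex.sinh (Real.pi * Complex.I * z))
      ((-1) ^ m * (Real.pi * Complex.I)) m := by
    have h1 : HasDerivAt (fun z : ℂ => Real.pi * Complex.I * z) (Real.pi * Complex.I) m := by
      simpa using (hasDerivAt_id (m : ℂ)).const_mul (Real.pi * Complex.I)
    have := h1.csinh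
    rwa [cosh_pi_I_mul_int] at this
  have h0 : Complex.sinh (Real.pi * Complex.I * m) = 0 :=
    (sinh_pi_I_mul_eq_zero_iff _).mpr ⟨m, rfl⟩
  have hne : (-1 : ℂ) ^ m * (Real.pi * Complex.I) ≠ 0 :=
    mul_ne_zero (zpow_ne_zero _ (by simp)) (mul_ne_zero hpi Complex.I_ne_zero)
  have h1 := (hasDerivAt_iff_tendsto_slope.mp hd).inv₀ hne
  have hm' : (m : ℂ) ≠ 0 := by exact_mod_cast hm
  have hc : ContinuousAt (fun z : ℂ => z ^ ((n : ℤ) - 1 - 2 * p) /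
      ∏ j ∈ Finset.Icc 1 (n - 1),
        Complex.sinh (Real.pi * Complex.I * (etaRoot n ^ j * z))) m := by
    refine (continuousAt_zpow₀ _ _ (Or.inl hm')).div (by fun_prop) ?_
    refine Finset.prod_ne_zero_iff.mpr fun j hj => ?_
    rw [Finset.mem_Icc] at hj
    exact sinh_pi_I_mul_ne_zero (by omega) (by omega) hm
  have h2 := h1.mul (hc.tendsto.mono_left nhdsWithin_le_nhds)
  have hone : ((-1 : ℂ) ^ m)⁻¹ = (-1) ^ m := by
    rw [← inv_zpow]; norm_num
  convert h2 using 2 with z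
  · rw [slope_def_field, h0, sub_zero, inv_div, sinhKernel, prod_range_eq_mul_prod_Icc hn]
    simp only [pow_zero, one_mul]
    rw [div_mul_div_comm, mul_div_assoc]
  · rw [sinhTerm_eq, mul_inv, hone]
    ring

theorem tendsto_residue_sinhKernel {n : ℕ} (hn : n ≠ 0) (p : ℤ) (j : ℕ) {m : ℤ} (hm : m ≠ 0) :
    Tendsto (fun z => (z - etaRoot n ^ j * m) * sinhKernel n p z) (𝓝[≠] (etaRoot n ^ j * m))
      (𝓝 (etaRoot n ^ ((j : ℤ) * (1 - (2 * p + 1))) *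
        (sinhTerm n p m / (Real.pi * Complex.I)))) := by
  have hη : etaRoot n ^ j ≠ 0 := pow_ne_zero j (etaRoot_ne_zero n)
  have ht : Tendsto (fun z => (etaRoot n ^ j)⁻¹ * z) (𝓝[≠] (etaRoot n ^ j * m))
      (𝓝[≠] (m : ℂ)) := by
    refine tendsto_nhdsWithin_iff.mpr ⟨?_, ?_⟩
    · have hc : Continuous fun z : ℂ => (etaRoot n ^ j)⁻¹ * z := by fun_prop
      have := hc.tendsto (etaRoot n ^ j * m)
      rw [inv_mul_cancel_left₀ hη] at this
      exact this.mono_left nhdsWithin_le_nhds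
    · filter_upwards [self_mem_nhdsWithin] with z hz h
      refine hz ?_
      rw [Set.mem_singleton_iff] at h ⊢
      rw [← h, mul_inv_cancel_left₀ hη]
  refine (((tendsto_residue_sinhKernel_int hn p hm).comp ht).const_mul
    (etaRoot n ^ ((j : ℤ) * (1 - (2 * p + 1))))).congr fun z => ?_
  obtain ⟨w, rfl⟩ : ∃ w, z = etaRoot n ^ j * w :=
    ⟨(etaRoot n ^ j)⁻¹ * z, (mul_inv_cancel_left₀ hη z).symm⟩
  rw [Function.comp_apply, inv_mul_cancel_left₀ hη, sinhKernel_etaRoot_pow_mul hn, ← mul_sub,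
    show (j : ℤ) * (1 - (2 * p + 1)) = j + j * (-1 - 2 * p) by ring,
    zpow_add₀ (etaRoot_ne_zero n), zpow_natCast]
  ring

/-! ### Absolute convergence -/

theorem exists_norm_sinh_ge (n : ℕ) : ∃ b > 0, ∃ c > 0, ∀ j ∈ Finset.Icc 1 (n - 1), ∀ m : ℤ,
    m ≠ 0 → c * Real.exp (b * |(m : ℝ)|) ≤
      ‖Complex.sinh (Real.pi * Complex.I * (etaRoot n ^ j * m))‖ := by
  obtain ⟨b, hb, hbj⟩ : ∃ b > 0, ∀ j ∈ Finset.Icc 1 (n - 1), b ≤ (etaRoot n ^ j).im := by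
    rcases (Finset.Icc 1 (n - 1)).eq_empty_or_nonempty with h | h
    · exact ⟨1, one_pos, by simp [h]⟩
    · obtain ⟨k, hk, hmin⟩ := Finset.exists_min_image _ (fun j => (etaRoot n ^ j).im) h
      rw [Finset.mem_Icc] at hk
      exact ⟨_, im_etaRoot_pow_pos (by omega) (by omega), hmin⟩
  obtain ⟨c, hc, hcs⟩ := Real.exists_mul_exp_le_sinh (x₀ := Real.pi * b) (by positivity)
  refine ⟨Real.pi * b, by positivity, c, hc, fun j hj m hm => ?_⟩
  have h1 : (1 : ℝ) ≤ |(m : ℝ)| := by exact_mod_cast Int.one_le_abs hm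
  have h2 : Real.pi * b * |(m : ℝ)| ≤
      |(Real.pi * Complex.I * (etaRoot n ^ j * m)).re| := by
    have hre : (Real.pi * Complex.I * (etaRoot n ^ j * m)).re =
        -(Real.pi * ((etaRoot n ^ j).im * m)) := by
      have : (etaRoot n ^ j * (m : ℂ)).im = (etaRoot n ^ j).im * m := Complex.im_mul_intCast _ _
      simp [this]
    rw [hre, abs_neg, abs_mul, abs_mul, abs_of_pos Real.pi_pos, ← mul_assoc]
    gcongr
    exact (hbj j hj).trans (le_abs_self _)
  have h3 : Real.pi * b ≤ Real.pi * b * |(m : ℝ)| := le_mul_of_one_le_right (by positivity) h1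
  calc c * Real.exp (Real.pi * b * |(m : ℝ)|) ≤ Real.sinh (Real.pi * b * |(m : ℝ)|) := hcs _ h3
    _ ≤ Real.sinh |(Real.pi * Complex.I * (etaRoot n ^ j * m)).re| :=
        Real.sinh_le_sinh.mpr h2
    _ ≤ _ := sinh_abs_re_le_norm_sinh _

theorem summable_sinhTerm {n : ℕ} (hn : 2 ≤ n) (p : ℤ) : Summable (sinhTerm n p) := by
  obtain ⟨b, hb, c, hc, h⟩ := exists_norm_sinh_ge n
  set q : ℤ := (n : ℤ) - 1 - 2 * p with hq
  have hbound : ∀ m : ℤ, m ≠ 0 →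
      ‖sinhTerm n p m‖ ≤ (c ^ (n - 1))⁻¹ *
        (|(m : ℝ)| ^ q.toNat * Real.exp (-b * |(m : ℝ)|)) := by
    intro m hm
    have h1 : (1 : ℝ) ≤ |(m : ℝ)| := by exact_mod_cast Int.one_le_abs hm
    rw [sinhTerm_eq, norm_mul, norm_zpow, norm_div, norm_zpow, norm_prod, norm_neg, norm_one,
      one_zpow, one_mul, Complex.norm_intCast, ← hq, div_eq_mul_inv]
    have h2 : (c * Real.exp (b * |(m : ℝ)|)) ^ (n - 1) ≤ ∏ j ∈ Finset.Icc 1 (n - 1),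
        ‖Complex.sinh (Real.pi * Complex.I * (etaRoot n ^ j * m))‖ := by
      have := Finset.prod_le_prod (s := Finset.Icc 1 (n - 1))
        (f := fun _ => c * Real.exp (b * |(m : ℝ)|)) (fun _ _ => by positivity)
        fun j hj => h j hj m hm
      simpa using this
    have h3 : c ^ (n - 1) * Real.exp (b * |(m : ℝ)|) ≤
        (c * Real.exp (b * |(m : ℝ)|)) ^ (n - 1) := by
      rw [mul_pow]
      gcongr
      exact le_self_pow₀ (Real.one_le_exp (by positivity)) (by omega)
    have h4 : (|(m : ℝ)|) ^ q ≤ |(m : ℝ)| ^ q.toNat := by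
      rw [← zpow_natCast]
      exact zpow_le_zpow_right₀ h1 (Int.self_le_toNat q)
    calc |(m : ℝ)| ^ q * (∏ j ∈ Finset.Icc 1 (n - 1),
          ‖Complex.sinh (Real.pi * Complex.I * (etaRoot n ^ j * m))‖)⁻¹
        ≤ |(m : ℝ)| ^ q.toNat * (c ^ (n - 1) * Real.exp (b * |(m : ℝ)|))⁻¹ := by
          gcongr
          exact h3.trans h2
      _ = _ := by rw [mul_inv, neg_mul, Real.exp_neg]; ring
  have hnat : Summable fun k : ℕ =>
      (c ^ (n - 1))⁻¹ * ((k : ℝ) ^ q.toNat * Real.exp (-b * k)) :=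
    (Real.summable_pow_mul_exp_neg_nat_mul q.toNat hb).mul_left _
  have hle : ∀ k : ℕ, ∀ m : ℤ, |(m : ℝ)| = k →
      ‖sinhTerm n p m‖ ≤ (c ^ (n - 1))⁻¹ * ((k : ℝ) ^ q.toNat * Real.exp (-b * k)) := by
    intro k m hmk
    rcases eq_or_ne m 0 with rfl | hm
    · rw [sinhTerm_zero hn, norm_zero]
      positivity
    · rw [← hmk]
      exact hbound m hm
  exact Summable.of_nat_of_neg
    (Summable.of_norm_bounded hnat fun k => hle k k (by simp))
    (Summable.of_norm_bounded hnat fun k => hle k (-k) (by simp))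

/-! ### The contour integral -/

/-- As `η` is not real, `|Im z| + |Im ηz|` controls `|z|`. -/
theorem exists_mul_norm_le_sum_abs_im {n : ℕ} (hn : 2 ≤ n) :
    ∃ κ > 0, ∀ z : ℂ, κ * ‖z‖ ≤ ∑ j ∈ Finset.range n, |(etaRoot n ^ j * z).im| := by
  have hσ : 0 < (etaRoot n ^ 1).im := im_etaRoot_pow_pos one_pos hn
  rw [pow_one] at hσ
  have hre : |(etaRoot n).re| ≤ 1 := by
    have h1 := norm_etaRoot_pow n 1
    rw [pow_one] at h1
    exact h1 ▸ Complex.abs_re_le_norm (etaRoot n)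
  have him : |(etaRoot n).im| ≤ 1 := by
    have h1 := norm_etaRoot_pow n 1
    rw [pow_one] at h1
    exact h1 ▸ Complex.abs_im_le_norm (etaRoot n)
  rw [abs_of_pos hσ] at him
  refine ⟨(etaRoot n).im / 2, by positivity, fun z => ?_⟩
  have hsub : ∑ j ∈ Finset.range 2, |(etaRoot n ^ j * z).im| ≤
      ∑ j ∈ Finset.range n, |(etaRoot n ^ j * z).im| :=
    Finset.sum_le_sum_of_subset_of_nonneg (Finset.range_subset_range.mpr hn)
      fun _ _ _ => abs_nonneg _
  refine le_trans ?_ hsub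
  simp only [Finset.sum_range_succ, Finset.sum_range_zero, pow_zero, one_mul, pow_one, zero_add]
  have h1 : ‖z‖ ≤ |z.re| + |z.im| := Complex.norm_le_abs_re_add_abs_im z
  have h2 : (etaRoot n).im * |z.re| ≤ |(etaRoot n * z).im| + |z.im| := by
    have h3 : (etaRoot n).im * z.re = (etaRoot n * z).im - (etaRoot n).re * z.im := by
      rw [Complex.mul_im]; ring
    calc (etaRoot n).im * |z.re| = |(etaRoot n).im * z.re| := by rw [abs_mul, abs_of_pos hσ]
      _ ≤ |(etaRoot n * z).im| + |(etaRoot n).re * z.im| := by rw [h3]; exact abs_sub _ _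
      _ ≤ _ := by
        rw [abs_mul]
        have := mul_le_mul_of_nonneg_right hre (abs_nonneg z.im)
        linarith
  have h4 : (etaRoot n).im * |z.im| ≤ |z.im| := by
    have := mul_le_mul_of_nonneg_right him (abs_nonneg z.im)
    linarith
  have h5 := mul_le_mul_of_nonneg_left h1 hσ.le
  have h6 := abs_nonneg (etaRoot n * z).im
  nlinarith

theorem half_le_norm_sub_intCast {N : ℕ} {v : ℂ} (hv : ‖v‖ = N + 1 / 2) (m : ℤ) :
    1 / 2 ≤ ‖v - m‖ := by
  have h1 : |‖v‖ - ‖(m : ℂ)‖| ≤ ‖v - m‖ := abs_norm_sub_norm_le _ _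
  refine le_trans ?_ h1
  have h2 : ‖(m : ℂ)‖ = (m.natAbs : ℝ) := by
    rw [Complex.norm_intCast, Nat.cast_natAbs, Int.cast_abs]
  rw [hv, h2]
  rcases le_or_gt m.natAbs N with h | h
  · have : (m.natAbs : ℝ) ≤ N := by exact_mod_cast h
    rw [abs_of_nonneg (by linarith)]
    linarith
  · have : (N : ℝ) + 1 ≤ m.natAbs := by exact_mod_cast h
    rw [abs_of_nonpos (by linarith)]
    linarith

/-- On the circles `|z| = N + 1/2` the kernel decays exponentially in `N`. -/
theorem tendsto_circleIntegral_sinhKernel {n : ℕ} (hn : 2 ≤ n) (p : ℤ) :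
    Tendsto (fun N : ℕ => ∮ z in C(0, (N : ℝ) + 1 / 2), sinhKernel n p z) atTop (𝓝 0) := by
  obtain ⟨κ, hκ, hsum⟩ := exists_mul_norm_le_sum_abs_im hn
  obtain ⟨c, hc, hsinh⟩ := exists_mul_exp_le_norm_sinh
  set q : ℤ := (n : ℤ) - 1 - 2 * p with hq
  have hbound : ∀ N : ℕ, ∀ z ∈ Metric.sphere (0 : ℂ) ((N : ℝ) + 1 / 2), ‖sinhKernel n p z‖ ≤
      (c ^ n)⁻¹ * (((N : ℝ) + 1 / 2) ^ q * Real.exp (-(Real.pi * κ) * ((N : ℝ) + 1 / 2))) := by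
    intro N z hz
    rw [mem_sphere_zero_iff_norm] at hz
    have h1 : ∏ j ∈ Finset.range n, (c * Real.exp (Real.pi * |(etaRoot n ^ j * z).im|)) ≤
        ∏ j ∈ Finset.range n,
          ‖Complex.sinh (Real.pi * Complex.I * (etaRoot n ^ j * z))‖ := by
      refine Finset.prod_le_prod (fun _ _ => by positivity) fun j _ => hsinh _ ?_
      refine half_le_norm_sub_intCast (N := N) ?_
      rw [norm_mul, norm_etaRoot_pow, one_mul, hz]
    rw [Finset.prod_mul_distrib, Finset.prod_const, Finset.card_range, ← Real.exp_sum,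
      ← Finset.mul_sum] at h1
    have h2 : c ^ n * Real.exp (Real.pi * (κ * ‖z‖)) ≤ ∏ j ∈ Finset.range n,
        ‖Complex.sinh (Real.pi * Complex.I * (etaRoot n ^ j * z))‖ := by
      refine le_trans ?_ h1
      have := hsum z
      gcongr
    rw [sinhKernel, norm_div, norm_zpow, norm_prod, ← hq, hz, div_eq_mul_inv]
    rw [hz] at h2
    calc _ ≤ ((N : ℝ) + 1 / 2) ^ q *
          (c ^ n * Real.exp (Real.pi * (κ * ((N : ℝ) + 1 / 2))))⁻¹ := by gcongr
      _ = _ := by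
        rw [mul_inv, neg_mul, Real.exp_neg, mul_assoc Real.pi]
        ring
  have hlim : Tendsto (fun x : ℝ => 2 * Real.pi * (c ^ n)⁻¹ *
      (x ^ ((q + 1 : ℤ) : ℝ) * Real.exp (-(Real.pi * κ) * x))) atTop (𝓝 0) := by
    simpa using (tendsto_rpow_mul_exp_neg_mul_atTop_nhds_zero ((q + 1 : ℤ) : ℝ) (Real.pi * κ)
      (by positivity)).const_mul (2 * Real.pi * (c ^ n)⁻¹)
  have hN : Tendsto (fun N : ℕ => (N : ℝ) + 1 / 2) atTop atTop :=
    tendsto_atTop_add_const_right _ _ tendsto_natCast_atTop_atTop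
  refine squeeze_zero_norm (fun N => ?_) (hlim.comp hN)
  have hR : (0 : ℝ) < (N : ℝ) + 1 / 2 := by positivity
  refine (circleIntegral.norm_integral_le_of_norm_le_const hR.le (hbound N)).trans (le_of_eq ?_)
  rw [Function.comp_apply, Real.rpow_intCast, zpow_add_one₀ hR.ne']
  ring

theorem prod_etaRoot_pow (n : ℕ) :
    ∏ j : Fin n, etaRoot n ^ (j : ℕ) = etaRoot n ^ (n * (n - 1) / 2) := by
  rw [Finset.prod_pow_eq_pow_sum, Fin.sum_univ_eq_sum_range (fun j => j), Finset.sum_range_id]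

theorem prod_halfDivSinh {n : ℕ} {z : ℂ} (hz : z ≠ 0) :
    ∏ j : Fin n, halfDivSinh (etaRoot n ^ (j : ℕ) * z) =
      etaRoot n ^ (n * (n - 1) / 2) * z ^ n /
        ∏ j ∈ Finset.range n, (2 * Complex.sinh (etaRoot n ^ j * z / 2)) := by
  have h : ∀ j : Fin n, halfDivSinh (etaRoot n ^ (j : ℕ) * z) =
      etaRoot n ^ (j : ℕ) * z / (2 * Complex.sinh (etaRoot n ^ (j : ℕ) * z / 2)) := fun j => by
    rw [halfDivSinh, if_neg (mul_ne_zero (pow_ne_zero _ (etaRoot_ne_zero n)) hz), div_div]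
  simp only [h, Finset.prod_div_distrib, Finset.prod_mul_distrib, prod_etaRoot_pow]
  rw [Finset.prod_const, Finset.card_univ, Fintype.card_fin, Finset.prod_const, Finset.card_univ,
    Fintype.card_fin, Fin.prod_univ_eq_prod_range (fun j => Complex.sinh (etaRoot n ^ j * z / 2)),
    Finset.prod_const, Finset.card_range]

theorem sinhKernel_eq_mul_prod_halfDivSinh {n : ℕ} (p : ℤ) {z : ℂ} (hz : z ≠ 0) :
    sinhKernel n p z = (2 / (2 * Real.pi * Complex.I)) ^ n / etaRoot n ^ (n * (n - 1) / 2) *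
      (z ^ (-1 - 2 * p) *
        ∏ j : Fin n, halfDivSinh (etaRoot n ^ (j : ℕ) * (2 * Real.pi * Complex.I * z))) := by
  have hpi : (Real.pi : ℂ) ≠ 0 := by exact_mod_cast Real.pi_ne_zero
  have hI := Complex.I_ne_zero
  have h2 : 2 * Real.pi * Complex.I ≠ 0 := by simp [hpi]
  have harg : ∀ j, etaRoot n ^ j * (2 * Real.pi * Complex.I * z) / 2 =
      Real.pi * Complex.I * (etaRoot n ^ j * z) := fun j => by ring
  rw [prod_halfDivSinh (mul_ne_zero h2 hz)]
  simp only [harg]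
  rw [sinhKernel, Finset.prod_mul_distrib, Finset.prod_const, Finset.card_range,
    show (n : ℤ) - 1 - 2 * p = n + (-1 - 2 * p) by ring, zpow_add₀ hz, zpow_natCast]
  have hE : etaRoot n ^ (n * (n - 1) / 2) ≠ 0 := pow_ne_zero _ (etaRoot_ne_zero n)
  have h3 : (2 * Real.pi * Complex.I) ^ n ≠ 0 := pow_ne_zero _ h2
  rw [mul_pow _ z, div_pow]
  generalize (2 * Real.pi * Complex.I) ^ n = A at *
  generalize etaRoot n ^ (n * (n - 1) / 2) = E at *
  generalize (∏ j ∈ Finset.range n,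
    Complex.sinh (Real.pi * Complex.I * (etaRoot n ^ j * z))) = S
  field_simp

/-- The residue at `0` of the kernel, which is holomorphic there if `p < 0`. -/
noncomputable def sinhKernelResidueZero (n : ℕ) (p : ℤ) : ℂ :=
  if 0 ≤ p then (2 / (2 * Real.pi * Complex.I)) ^ n / etaRoot n ^ (n * (n - 1) / 2) *
    (PowerSeries.coeff (2 * p).toNat (sinhProdSeries n) *
      (2 * Real.pi * Complex.I) ^ (2 * p).toNat) else 0

theorem circleIntegral_sinhKernel {n : ℕ} (hn : 2 ≤ n) (p : ℤ) (N : ℕ) :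
    (∮ z in C(0, (N : ℝ) + 1 / 2), sinhKernel n p z) = 2 * Real.pi * Complex.I *
      (calZ n (2 * p + 1) * ((∑ m ∈ Finset.Icc (-N : ℤ) N, sinhTerm n p m) /
        (Real.pi * Complex.I)) + sinhKernelResidueZero n p) := by
  have hR : (0 : ℝ) < (N : ℝ) + 1 / 2 := by positivity
  set A : ℂ := (2 / (2 * Real.pi * Complex.I)) ^ n / etaRoot n ^ (n * (n - 1) / 2) with hA
  set T := PowerSeries.rescale (2 * Real.pi * Complex.I) (sinhProdSeries n) with hT
  have hTs := (hasTaylorSeries_prod_halfDivSinh n).comp_mul_left (2 * Real.pi * Complex.I)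
  rw [← hT] at hTs
  set K : ℕ := (2 * p + 1).toNat with hK
  -- the principal part of the kernel at `0`
  set L : ℂ → ℂ := fun z =>
    ∑ k ∈ Finset.range K, A * PowerSeries.coeff k T * (z - 0) ^ ((k : ℤ) - 1 - 2 * p) with hL
  set s : Finset (ℕ × ℤ) :=
    insert (0, 0) (Finset.range n ×ˢ (Finset.Icc (-N : ℤ) N).erase 0) with hs
  have hmem : ∀ i ∈ s, i ≠ (0, 0) → i.1 < n ∧ i.2 ≠ 0 ∧ |i.2| ≤ N := by
    intro i hi hne
    rw [hs, Finset.mem_insert, Finset.mem_product, Finset.mem_range, Finset.mem_erase,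
      Finset.mem_Icc] at hi
    obtain ⟨h1, h2, h3⟩ := hi.resolve_left hne
    exact ⟨h1, h2, abs_le.mpr h3⟩
  have hLd : ∀ z ≠ 0, DifferentiableAt ℂ L z := fun z hz =>
    DifferentiableAt.fun_sum fun k _ => by
      refine DifferentiableAt.const_mul ?_ _
      simp only [sub_zero]
      exact differentiableAt_zpow.mpr (Or.inl hz)
  have hres := circleIntegral_eq_sum_residues s
    (a := fun i => etaRoot n ^ i.1 * i.2)
    (r := fun i => etaRoot n ^ ((i.1 : ℤ) * (1 - (2 * p + 1))) *
        (sinhTerm n p i.2 / (Real.pi * Complex.I)))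
    (f := fun z => sinhKernel n p z - L z) hR ?_ ?_ ?_ ?_
  · have hLint : (∮ z in C(0, (N : ℝ) + 1 / 2), L z) =
        2 * Real.pi * Complex.I * sinhKernelResidueZero n p := by
      have hterm : ∀ k : ℕ, (∮ z in C(0, (N : ℝ) + 1 / 2),
          A * PowerSeries.coeff k T * (z - 0) ^ ((k : ℤ) - 1 - 2 * p)) =
          if (k : ℤ) = 2 * p then 2 * Real.pi * Complex.I * (A * PowerSeries.coeff k T)
            else 0 := by
        intro k
        rw [circleIntegral.integral_const_mul]
        split_ifs with hk
        · rw [hk, show 2 * p - 1 - 2 * p = (-1 : ℤ) by ring]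
          simp only [zpow_neg_one]
          rw [circleIntegral.integral_sub_center_inv _ hR.ne']
          ring
        · rw [circleIntegral.integral_sub_zpow_of_ne (by omega), mul_zero]
      rw [hL, circleIntegral.integral_fun_sum, Finset.sum_congr rfl fun k _ => hterm k]
      · rw [sinhKernelResidueZero]
        split_ifs with hp
        · rw [Finset.sum_eq_single (2 * p).toNat]
          · rw [if_pos (by omega), hT, PowerSeries.coeff_rescale]
            ring
          · intro k _ hk
            rw [if_neg (by omega)]
          · intro h
            rw [Finset.mem_range] at h
            omega
        · rw [mul_zero]
          exact Finset.sum_eq_zero fun k _ => if_neg (by omega)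
      · intro k _
        refine ContinuousOn.circleIntegrable hR.le fun z hz => ?_
        have hz0 : z ≠ 0 := by
          rintro rfl
          rw [mem_sphere_zero_iff_norm, norm_zero] at hz
          exact hR.ne hz
        simp only [sub_zero]
        exact (continuousAt_const.mul
          (continuousAt_zpow₀ _ _ (Or.inl hz0))).continuousWithinAt
    have hoff : ∀ z ∈ Metric.sphere (0 : ℂ) ((N : ℝ) + 1 / 2),
        DifferentiableAt ℂ (sinhKernel n p) z ∧ z ≠ 0 := by
      intro z hz
      rw [mem_sphere_zero_iff_norm] at hz
      have hz0 : z ≠ 0 := by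
        rintro rfl
        rw [norm_zero] at hz
        exact hR.ne hz
      refine ⟨differentiableAt_sinhKernel p hz0 fun k _ l hzl => ?_, hz0⟩
      rw [hzl, norm_mul, norm_etaRoot_pow, one_mul] at hz
      have := half_le_norm_sub_intCast hz l
      rw [sub_self, norm_zero] at this
      norm_num at this
    have hint1 : CircleIntegrable (sinhKernel n p) 0 ((N : ℝ) + 1 / 2) :=
      ContinuousOn.circleIntegrable hR.le fun z hz =>
        (hoff z hz).1.continuousAt.continuousWithinAt
    have hint2 : CircleIntegrable L 0 ((N : ℝ) + 1 / 2) :=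
      ContinuousOn.circleIntegrable hR.le fun z hz =>
        (hLd z (hoff z hz).2).continuousAt.continuousWithinAt
    rw [circleIntegral.integral_sub hint1 hint2, hLint, sub_eq_iff_eq_add] at hres
    rw [hres, mul_add]
    congr 2
    rw [hs, Finset.sum_insert (by simp), sinhTerm_zero hn, zero_div, mul_zero, zero_add,
      Finset.sum_product, calZ, Finset.sum_div, Finset.sum_mul_sum]
    refine Finset.sum_congr rfl fun j _ => ?_
    refine Finset.sum_erase _ ?_
    rw [sinhTerm_zero hn, zero_div, mul_zero]
  · intro i hi k hk hik
    have hη := etaRoot_ne_zero n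
    by_cases hi0 : i = (0, 0)
    · by_contra hne
      obtain ⟨_, h2, _⟩ := hmem k hk fun h => hne (hi0.trans h.symm)
      rw [hi0] at hik
      simp [hη, h2, eq_comm] at hik
    · by_cases hk0 : k = (0, 0)
      · obtain ⟨_, h2, _⟩ := hmem i hi hi0
        rw [hk0] at hik
        simp [hη, h2] at hik
      · obtain ⟨h1, h2, _⟩ := hmem i hi hi0
        obtain ⟨h3, h4, _⟩ := hmem k hk hk0
        exact Prod.ext_iff.mpr (eq_of_etaRoot_pow_mul_eq h1 h3 h2 h4 hik)
  · intro i hi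
    rw [mem_ball_zero_iff, norm_mul, norm_etaRoot_pow, one_mul, Complex.norm_intCast]
    have h1 : |i.2| ≤ N := by
      by_cases hi0 : i = (0, 0)
      · simp [hi0]
      · exact (hmem i hi hi0).2.2
    have h2 : |(i.2 : ℝ)| ≤ N := by exact_mod_cast h1
    linarith
  · intro z hz hzs
    have hz0 : z ≠ 0 := by simpa using hzs (0, 0) (Finset.mem_insert_self _ _)
    refine (differentiableAt_sinhKernel p hz0 fun k hk l hzl => ?_).sub (hLd z hz0)
    have hl0 : l ≠ 0 := by rintro rfl; simp at hzl; exact hz0 hzl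
    refine hzs (k, l) (Finset.mem_insert_of_mem ?_) hzl
    rw [Finset.mem_product, Finset.mem_range, Finset.mem_erase, Finset.mem_Icc, ← abs_le]
    refine ⟨hk, hl0, ?_⟩
    rw [mem_closedBall_zero_iff, hzl, norm_mul, norm_etaRoot_pow, one_mul,
      Complex.norm_intCast] at hz
    have h1 : |(l : ℝ)| < ((N + 1 : ℤ) : ℝ) := by push_cast; linarith
    have h2 : |l| < N + 1 := by exact_mod_cast h1
    exact Int.lt_add_one_iff.mp h2
  · intro i hi
    by_cases hi0 : i = (0, 0)
    · subst hi0
      simp only [Int.cast_zero, mul_zero, sub_zero, sinhTerm_zero hn, zero_div]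
      -- `z (kernel - principal part) = A z^(-2p) (Taylor remainder of order K > 2p) → 0`
      have h1 : Tendsto (fun z : ℂ => z ^ ((K : ℤ) - 2 * p)) (𝓝[≠] 0) (𝓝 0) := by
        have hc := continuousAt_zpow₀ (0 : ℂ) ((K : ℤ) - 2 * p) (Or.inr (by omega))
        have := hc.tendsto.mono_left (nhdsWithin_le_nhds (s := {(0 : ℂ)}ᶜ))
        rwa [zero_zpow _ (by omega)] at this
      have h2 := ((hTs.isBigO_sub_sum K).mono nhdsWithin_le_nhds).mul
        (Asymptotics.isBigO_refl (fun z : ℂ => z ^ (-2 * p)) (𝓝[≠] 0))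
      have h3 := ((h2.trans_tendsto (h1.congr' ?_)).const_mul A).congr' ?_ (f₂ := fun z =>
        z * (sinhKernel n p z - L z))
      · simpa using h3
      · filter_upwards [self_mem_nhdsWithin] with z hz
        rw [← zpow_natCast, ← zpow_add₀ hz]
        congr 1
        ring
      · filter_upwards [self_mem_nhdsWithin] with z hz
        have h4 : ∀ k : ℕ, z * z ^ ((k : ℤ) - 1 - 2 * p) = z ^ k * z ^ (-2 * p) := fun k => by
          rw [← zpow_natCast, ← zpow_one_add₀ hz, ← zpow_add₀ hz]
          congr 1
          ring
        have h5 : z * z ^ (-1 - 2 * p) = z ^ (-2 * p) := by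
          rw [← zpow_one_add₀ hz]
          congr 1
          ring
        rw [sinhKernel_eq_mul_prod_halfDivSinh p hz, ← hA, ← h5, mul_sub, hL]
        simp only [sub_zero, Finset.mul_sum]
        rw [sub_mul, mul_sub, Finset.sum_mul, Finset.mul_sum]
        congr 1
        · ring
        · refine Finset.sum_congr rfl fun k _ => ?_
          rw [h5]
          linear_combination (-A * PowerSeries.coeff k T) * h4 k
    · obtain ⟨_, h2, _⟩ := hmem i hi hi0
      have h3 : etaRoot n ^ i.1 * (i.2 : ℂ) ≠ 0 :=
        mul_ne_zero (pow_ne_zero _ (etaRoot_ne_zero n)) (by exact_mod_cast h2)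
      have h4 : Tendsto (fun z => (z - etaRoot n ^ i.1 * i.2) * L z)
          (𝓝[≠] (etaRoot n ^ i.1 * i.2)) (𝓝 0) := by
        have hc : ContinuousAt (fun z => (z - etaRoot n ^ i.1 * i.2) * L z)
            (etaRoot n ^ i.1 * i.2) :=
          (continuousAt_id.sub continuousAt_const).mul (hLd _ h3).continuousAt
        have := hc.tendsto.mono_left (nhdsWithin_le_nhds (s := {etaRoot n ^ i.1 * i.2}ᶜ))
        rwa [sub_self, zero_mul] at this
      have h5 := (tendsto_residue_sinhKernel (by omega) p i.1 h2).sub h4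
      rw [sub_zero] at h5
      exact h5.congr fun z => (mul_sub _ _ _).symm

theorem pi_I_mul_sinhKernelResidueZero (n : ℕ) (hn : 1 ≤ n) (p : ℤ) :
    Real.pi * Complex.I * sinhKernelResidueZero n p =
      2 ^ (n - 1) * (2 * Real.pi * Complex.I) ^ (2 * p + 1 - (n : ℤ)) /
          etaRoot n ^ (n * (n - 1) / 2) *
        ∑ m ∈ tuplesWithSum n p, ∏ ν : Fin n,
          bernoulliHalf (2 * m ν) / ((2 * m ν).factorial : ℂ) *
            etaRoot n ^ (2 * (ν : ℕ) * m ν) := by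
  have hpi : (Real.pi : ℂ) ≠ 0 := by exact_mod_cast Real.pi_ne_zero
  have h2 : 2 * Real.pi * Complex.I ≠ 0 := by simp [hpi]
  rw [sinhKernelResidueZero]
  split_ifs with hp
  · lift p to ℕ using hp
    obtain ⟨k, rfl⟩ := Nat.exists_eq_add_of_le' hn
    have hnat : (2 * (p : ℤ)).toNat = 2 * p := by omega
    rw [hnat, coeff_sinhProdSeries, Nat.add_sub_cancel, zpow_sub₀ h2, zpow_add₀ h2, zpow_one,
      zpow_natCast, show (2 * (p : ℤ)) = ((2 * p : ℕ) : ℤ) by push_cast; rfl, zpow_natCast,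
      show Real.pi * Complex.I = (2 * Real.pi * Complex.I) / 2 by ring, div_pow]
    generalize 2 * Real.pi * Complex.I = c
    generalize (∑ m ∈ tuplesWithSum _ _, _ : ℂ) = S
    rw [pow_succ (2 : ℂ)]
    ring
  · have hempty : tuplesWithSum n p = ∅ := by
      refine Finset.eq_empty_of_forall_notMem fun m hm => hp ?_
      rw [← (mem_tuplesWithSum n p m).mp hm]
      exact Int.natCast_nonneg _
    rw [hempty, Finset.sum_empty, mul_zero, mul_zero]

/-- The residue theorem, in the limit of large circles: the residues at the points `η^j m` sum up
to minus the residue at `0`. -/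
theorem calZ_mul_tsum_sinhTerm {n : ℕ} (hn : 2 ≤ n) (p : ℤ) :
    calZ n (2 * p + 1) * ∑' m : {m : ℤ // m ≠ 0}, sinhTerm n p m =
      -(Real.pi * Complex.I * sinhKernelResidueZero n p) := by
  have hpi : (Real.pi : ℂ) ≠ 0 := by exact_mod_cast Real.pi_ne_zero
  have hI := Complex.I_ne_zero
  have hsub : ∑' m : {m : ℤ // m ≠ 0}, sinhTerm n p m = ∑' m : ℤ, sinhTerm n p m := by
    refine tsum_subtype_eq_of_support_subset (f := sinhTerm n p) (s := {m | m ≠ 0}) ?_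
    intro m hm h0
    exact hm (h0 ▸ sinhTerm_zero hn p)
  have h1 : Tendsto (fun N : ℕ => ∑ m ∈ Finset.Icc (-N : ℤ) N, sinhTerm n p m) atTop
      (𝓝 (∑' m : ℤ, sinhTerm n p m)) := by
    refine (summable_sinhTerm hn p).hasSum.comp ?_
    refine tendsto_atTop_finset_of_monotone ?_ fun m => ⟨m.natAbs, ?_⟩
    · intro a b hab
      exact Finset.Icc_subset_Icc (by simpa using hab) (by simpa using hab)
    · rw [Finset.mem_Icc]
      omega
  have h2 := (((h1.div_const (Real.pi * Complex.I)).const_mul (calZ n (2 * p + 1))).add_const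
    (sinhKernelResidueZero n p)).const_mul (2 * Real.pi * Complex.I)
  have h3 := tendsto_nhds_unique
    ((tendsto_circleIntegral_sinhKernel hn p).congr (circleIntegral_sinhKernel hn p)) h2
  have h4 := mul_eq_zero.mp h3.symm
  have h5 := h4.resolve_left (by simp [hpi])
  rw [hsub]
  field_simp at h5
  linear_combination h5

/-! ### Gamma integrals with a complex rate -/

theorem norm_cpow_mul_exp_neg_mul {s r : ℂ} {t : ℝ} (ht : 0 < t) :
    ‖(t : ℂ) ^ (s - 1) * Complex.exp (-(r * t))‖ =
      t ^ (s.re - 1) * Real.exp (-(r.re * t)) := by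
  rw [norm_mul, Complex.norm_cpow_eq_rpow_re_of_pos ht, Complex.norm_exp]
  simp

theorem integrableOn_rpow_mul_exp_neg_mul {x b : ℝ} (hx : 0 < x) (hb : 0 < b) :
    IntegrableOn (fun t : ℝ => t ^ (x - 1) * Real.exp (-(b * t))) (Set.Ioi 0) := by
  have := integrableOn_rpow_mul_exp_neg_mul_rpow (s := x - 1) (by linarith) one_pos hb
  simpa using this

theorem continuousOn_ofReal_cpow (s : ℂ) :
    ContinuousOn (fun t : ℝ => (t : ℂ) ^ s) (Set.Ioi 0) := fun t ht =>
  (Complex.continuousAt_ofReal_cpow_const t s (Or.inr (ne_of_gt ht))).continuousWithinAt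

theorem integrableOn_cpow_mul_exp_neg_mul {s r : ℂ} (hs : 0 < s.re) (hr : 0 < r.re) :
    IntegrableOn (fun t : ℝ => (t : ℂ) ^ (s - 1) * Complex.exp (-(r * t))) (Set.Ioi 0) := by
  refine (integrableOn_rpow_mul_exp_neg_mul hs hr).mono' ?_ ?_
  · refine ContinuousOn.aestronglyMeasurable ?_ measurableSet_Ioi
    exact (continuousOn_ofReal_cpow _).mul (by fun_prop)
  · filter_upwards [self_mem_ae_restrict measurableSet_Ioi] with t ht
    exact (norm_cpow_mul_exp_neg_mul ht).le

/-- `r ↦ ∫ t^(s-1) e^(-rt) dt` is holomorphic on the right half-plane. -/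
theorem differentiableAt_integral_cpow_mul_exp {s r : ℂ} (hs : 0 < s.re) (hr : 0 < r.re) :
    DifferentiableAt ℂ
      (fun r : ℂ => ∫ t in Set.Ioi (0 : ℝ), (t : ℂ) ^ (s - 1) * Complex.exp (-(r * t))) r := by
  have hball : Metric.ball r (r.re / 2) ∈ 𝓝 r := Metric.ball_mem_nhds r (by positivity)
  have hre : ∀ x ∈ Metric.ball r (r.re / 2), r.re / 2 < x.re := by
    intro x hx
    rw [mem_ball_iff_norm] at hx
    have h1 := (abs_le.mp (Complex.abs_re_le_norm (x - r))).1
    rw [Complex.sub_re] at h1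
    linarith
  refine (hasDerivAt_integral_of_dominated_loc_of_deriv_le (μ := volume.restrict (Set.Ioi 0))
    (F := fun (r : ℂ) (t : ℝ) => (t : ℂ) ^ (s - 1) * Complex.exp (-(r * t)))
    (F' := fun (x : ℂ) (t : ℝ) => (t : ℂ) ^ (s - 1) * (Complex.exp (-(x * t)) * -(t : ℂ)))
    (bound := fun t : ℝ => t ^ ((s.re + 1) - 1) * Real.exp (-(r.re / 2 * t)))
    hball ?_ (integrableOn_cpow_mul_exp_neg_mul hs hr) ?_ ?_ ?_ ?_).2.differentiableAt
  · filter_upwards [hball] with x hx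
    exact (integrableOn_cpow_mul_exp_neg_mul hs
      ((by positivity : 0 < r.re / 2).trans (hre x hx))).aestronglyMeasurable
  · refine ContinuousOn.aestronglyMeasurable ?_ measurableSet_Ioi
    exact (continuousOn_ofReal_cpow _).mul (by fun_prop)
  · filter_upwards [self_mem_ae_restrict measurableSet_Ioi] with t ht x hx
    have ht' : (0 : ℝ) < t := ht
    rw [← mul_assoc, norm_mul, norm_cpow_mul_exp_neg_mul ht', norm_neg, Complex.norm_real,
      Real.norm_of_nonneg ht'.le, mul_right_comm, ← Real.rpow_add_one ht'.ne',
      show s.re - 1 + 1 = s.re + 1 - 1 by ring]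
    have := hre x hx
    gcongr
  · exact integrableOn_rpow_mul_exp_neg_mul (by linarith) (by positivity)
  · refine Eventually.of_forall fun t x _ => ?_
    have h1 : HasDerivAt (fun x : ℂ => -(x * t)) (-(t : ℂ)) x := by
      have := ((hasDerivAt_id x).mul_const (t : ℂ)).fun_neg
      rwa [one_mul] at this
    exact (h1.cexp).const_mul _

theorem integral_cpow_mul_exp_neg_mul_complex {s r : ℂ} (hs : 0 < s.re) (hr : 0 < r.re) :
    ∫ t in Set.Ioi (0 : ℝ), (t : ℂ) ^ (s - 1) * Complex.exp (-(r * t)) =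
      Complex.Gamma s / r ^ s := by
  set U : Set ℂ := {r | 0 < r.re} with hU
  have hopen : IsOpen U := isOpen_lt continuous_const Complex.continuous_re
  have hconn : IsPreconnected U := (convex_halfSpace_re_gt 0).isPreconnected
  have hL : AnalyticOnNhd ℂ
      (fun r : ℂ => ∫ t in Set.Ioi (0 : ℝ), (t : ℂ) ^ (s - 1) * Complex.exp (-(r * t))) U :=
    DifferentiableOn.analyticOnNhd (fun r hr =>
      (differentiableAt_integral_cpow_mul_exp hs hr).differentiableWithinAt) hopen
  have hR : AnalyticOnNhd ℂ (fun r : ℂ => Complex.Gamma s / r ^ s) U := by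
    refine DifferentiableOn.analyticOnNhd (fun r hr => ?_) hopen
    have hslit : r ∈ Complex.slitPlane := Or.inl hr
    have hr0 : r ^ s ≠ 0 := by
      rw [Complex.cpow_ne_zero_iff]
      exact Or.inl (Complex.slitPlane_ne_zero hslit)
    have hd : DifferentiableAt ℂ (fun r : ℂ => r ^ s) r :=
      differentiableAt_id.cpow_const hslit
    exact ((differentiableAt_const _).div hd hr0).differentiableWithinAt
  refine hL.eqOn_of_preconnected_of_frequently_eq hR hconn (z₀ := 1) (by simp [hU]) ?_ hr
  have ht : Tendsto (fun x : ℝ => (x : ℂ)) (𝓝[≠] 1) (𝓝[≠] 1) := by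
    refine tendsto_nhdsWithin_iff.mpr ⟨?_, ?_⟩
    · exact (Complex.continuous_ofReal.tendsto' 1 1 (by simp)).mono_left nhdsWithin_le_nhds
    · filter_upwards [self_mem_nhdsWithin] with x hx
      simpa using hx
  refine ht.frequently (Eventually.frequently ?_)
  filter_upwards [nhdsWithin_le_nhds (Ioi_mem_nhds (zero_lt_one' ℝ))] with x hx
  have hx' : (0 : ℝ) < x := hx
  rw [Complex.integral_cpow_mul_exp_neg_mul_Ioi hs hx', one_div, Complex.inv_cpow, mul_comm,
    div_eq_mul_inv]
  rw [Complex.arg_ofReal_of_nonneg hx'.le]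
  exact Real.pi_pos.ne

/-! ### Multiple sums over `ℕ^n` -/

theorem hasSum_prod_fin {n : ℕ} {f : Fin n → ℕ → ℂ} {a : Fin n → ℂ}
    (h : ∀ j, HasSum (f j) (a j)) :
    HasSum (fun m : Fin n → ℕ => ∏ j, f j (m j)) (∏ j, a j) := by
  induction n with
  | zero => simp
  | succ n ih =>
    have h1 := ih fun j => h j.succ
    have hs := summable_mul_of_summable_norm (h 0).summable.norm h1.summable.norm
    have h2 := (h 0).mul h1 hs
    rw [← (Fin.consEquiv fun _ : Fin (n + 1) => ℕ).hasSum_iff, Fin.prod_univ_succ]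
    refine h2.congr_fun fun x => ?_
    simp [Fin.prod_univ_succ, Fin.consEquiv]

theorem summable_prod_fin {n : ℕ} {f : Fin n → ℕ → ℝ} (h : ∀ j, Summable (f j)) :
    Summable fun m : Fin n → ℕ => ∏ j, f j (m j) := by
  have h1 := (hasSum_prod_fin fun j => (Complex.hasSum_ofReal.mpr (h j).hasSum)).summable
  exact Complex.summable_ofReal.mp (h1.congr fun m => by push_cast; rfl)

/-- Convergence of the Barnes series: `∏ (m_j + 1) ≤ (1 + ∑ m_j)^n` reduces it to a product of
`n` one-dimensional series with exponent `σ / n > 1`. -/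
theorem summable_one_div_linear_rpow {n : ℕ} (hn : 1 ≤ n) {b : ℝ} {w : Fin n → ℝ} (hb : 0 < b)
    (hw : ∀ j, 0 < w j) {σ : ℝ} (hσ : n < σ) :
    Summable fun m : Fin n → ℕ => 1 / (b + ∑ j, w j * m j) ^ σ := by
  have hn' : (0 : ℝ) < n := by exact_mod_cast hn
  have hσ0 : 0 < σ := hn'.trans hσ
  obtain ⟨β, hβ, hβb, hβw⟩ : ∃ β > 0, β ≤ b ∧ ∀ j, β ≤ w j := by
    have : Nonempty (Fin n) := ⟨⟨0, hn⟩⟩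
    obtain ⟨k, hk⟩ := Finite.exists_min w
    exact ⟨min b (w k), lt_min hb (hw k), min_le_left _ _, fun j => (min_le_right _ _).trans (hk j)⟩
  have hone : Summable fun k : ℕ => 1 / ((k : ℝ) + 1) ^ (σ / n) := by
    have h1 := Real.summable_one_div_nat_rpow.mpr ((one_lt_div hn').mpr hσ)
    simpa using (summable_nat_add_iff 1).mpr h1
  have hprod := (summable_prod_fin fun _ : Fin n => hone).mul_left (1 / β ^ σ)
  refine Summable.of_nonneg_of_le (fun m => ?_) (fun m => ?_) hprod
  · have : 0 ≤ ∑ j, w j * (m j : ℝ) :=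
      Finset.sum_nonneg fun j _ => mul_nonneg (hw j).le (Nat.cast_nonneg _)
    positivity
  · set S : ℝ := 1 + ∑ j, (m j : ℝ) with hS
    have hS0 : 0 < S := by positivity
    have h1 : β * S ≤ b + ∑ j, w j * m j := by
      rw [hS, mul_add, mul_one, Finset.mul_sum]
      refine add_le_add hβb (Finset.sum_le_sum fun j _ => ?_)
      exact mul_le_mul_of_nonneg_right (hβw j) (Nat.cast_nonneg _)
    have h2 : ∏ j, ((m j : ℝ) + 1) ^ (σ / n) ≤ S ^ σ := by
      have h3 : ∀ j ∈ Finset.univ, ((m j : ℝ) + 1) ^ (σ / n) ≤ S ^ (σ / n) := fun j _ => by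
        have : (m j : ℝ) ≤ ∑ j, (m j : ℝ) :=
          Finset.single_le_sum (fun i _ => Nat.cast_nonneg (m i)) (Finset.mem_univ j)
        gcongr
        linarith
      refine (Finset.prod_le_prod (fun j _ => by positivity) h3).trans (le_of_eq ?_)
      rw [Finset.prod_const, Finset.card_univ, Fintype.card_fin, ← Real.rpow_mul_natCast hS0.le,
        div_mul_cancel₀ _ hn'.ne']
    have h4 : β ^ σ * ∏ j, ((m j : ℝ) + 1) ^ (σ / n) ≤ (b + ∑ j, w j * m j) ^ σ := by
      calc _ ≤ β ^ σ * S ^ σ := by gcongr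
        _ = (β * S) ^ σ := (Real.mul_rpow hβ.le hS0.le).symm
        _ ≤ _ := by gcongr
    rw [Finset.prod_div_distrib, Finset.prod_const_one, div_mul_div_comm, one_mul]
    have : 0 < β ^ σ * ∏ j, ((m j : ℝ) + 1) ^ (σ / n) := by positivity
    exact one_div_le_one_div_of_le this h4

/-! ### The Mellin transform of the generating function -/

/-- The Mellin transform of `e^(-bu) / ∏ (1 - e^(-w_j u))` is, termwise, `Γ(s)` times the Barnes
series. -/
theorem hasSum_mellin_barnes {n : ℕ} (hn : 1 ≤ n) {b : ℂ} {w : Fin n → ℂ} (hb : 0 < b.re)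
    (hw : ∀ j, 0 < (w j).re) {s : ℂ} (hs : n < s.re) :
    HasSum (fun m : Fin n → ℕ => Complex.Gamma s / (b + ∑ j, w j * m j) ^ s)
      (mellin (fun u => Complex.exp (-(b * u)) * ∏ j, (1 - Complex.exp (-(w j * u)))⁻¹) s) := by
  have hs0 : 0 < s.re := lt_of_le_of_lt (Nat.cast_nonneg n) hs
  have hre : ∀ m : Fin n → ℕ, (b + ∑ j, w j * m j).re = b.re + ∑ j, (w j).re * m j := fun m => by
    simp [Complex.re_sum]
  have hpos : ∀ m : Fin n → ℕ, 0 < (b + ∑ j, w j * m j).re := fun m => by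
    rw [hre]
    have : 0 ≤ ∑ j, (w j).re * (m j : ℝ) :=
      Finset.sum_nonneg fun j _ => mul_nonneg (hw j).le (Nat.cast_nonneg _)
    linarith
  have hmain := hasSum_integral_of_summable_integral_norm (μ := volume.restrict (Set.Ioi 0))
    (F := fun (m : Fin n → ℕ) (t : ℝ) =>
      (t : ℂ) ^ (s - 1) * Complex.exp (-((b + ∑ j, w j * m j) * t)))
    (fun m => integrableOn_cpow_mul_exp_neg_mul hs0 (hpos m)) ?_
  · simp only [integral_cpow_mul_exp_neg_mul_complex hs0 (hpos _)] at hmain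
    suffices h : mellin (fun u => Complex.exp (-(b * u)) *
          ∏ j, (1 - Complex.exp (-(w j * u)))⁻¹) s = ∫ t in Set.Ioi (0 : ℝ),
            ∑' m : Fin n → ℕ, (t : ℂ) ^ (s - 1) * Complex.exp (-((b + ∑ j, w j * m j) * t)) by
      rw [h]
      exact hmain
    rw [mellin]
    refine setIntegral_congr_fun measurableSet_Ioi fun t ht => ?_
    have ht' : (0 : ℝ) < t := ht
    have hgeom : ∀ j, HasSum (fun k : ℕ => Complex.exp (-(w j * t)) ^ k)
        (1 - Complex.exp (-(w j * t)))⁻¹ := fun j => by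
      refine hasSum_geometric_of_norm_lt_one ?_
      rw [Complex.norm_exp, Real.exp_lt_one_iff]
      have h1 : 0 < (w j).re * t := mul_pos (hw j) ht'
      simpa using h1
    have h0 := (hasSum_prod_fin hgeom).mul_left (Complex.exp (-(b * t)))
    have h1 := h0.mul_left
      ((t : ℂ) ^ (s - 1))
    rw [smul_eq_mul, ← h1.tsum_eq]
    refine tsum_congr fun m => ?_
    simp only [← Complex.exp_nat_mul]
    rw [← Complex.exp_sum, ← Complex.exp_add]
    congr 2
    rw [add_mul, neg_add, Finset.sum_mul, ← Finset.sum_neg_distrib]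
    congr 1
    exact Finset.sum_congr rfl fun j _ => by ring
  · have hnorm : ∀ m : Fin n → ℕ, ∫ t in Set.Ioi (0 : ℝ),
        ‖(t : ℂ) ^ (s - 1) * Complex.exp (-((b + ∑ j, w j * m j) * t))‖ =
        Real.Gamma s.re * (1 / (b.re + ∑ j, (w j).re * m j) ^ s.re) := fun m => by
      rw [setIntegral_congr_fun measurableSet_Ioi fun t ht => norm_cpow_mul_exp_neg_mul ht,
        Real.integral_rpow_mul_exp_neg_mul_Ioi hs0 (hpos m), hre,
        Real.div_rpow zero_le_one (hre m ▸ (hpos m).le), Real.one_rpow, mul_comm]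
    simp only [hnorm]
    exact (summable_one_div_linear_rpow hn hb hw hs).mul_left _

/-! ### The polar part of a Mellin transform -/

/-- The Mellin transform `∑ c_k / (s + k - n)` of `u ↦ ∑ c_k u^(k-n)` on `(0, 1]`, as a function
on all of `ℂ`. -/
noncomputable def polarSeries (n : ℕ) (c : ℕ → ℂ) (s : ℂ) : ℂ :=
  ∑' k : ℕ, c k / (s + k - n)

section polarSeries

variable {n : ℕ} {c : ℕ → ℂ}

theorem norm_div_le_of_one_lt_re {K k : ℕ} {s : ℂ} (hs : 1 < (s + K - n).re) :
    ‖c (k + K) / (s + (k + K : ℕ) - n)‖ ≤ ‖c (k + K)‖ := by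
  rw [norm_div]
  refine div_le_self (norm_nonneg _) ?_
  have h1 := Complex.re_le_norm (s + (k + K : ℕ) - n)
  simp only [Complex.sub_re, Complex.add_re, Complex.natCast_re] at h1 hs
  have h2 : (0 : ℝ) ≤ k := Nat.cast_nonneg k
  push_cast at h1 ⊢
  linarith

theorem polarSeries_eq_sum_add_tsum (hc : Summable fun k => ‖c k‖) {K : ℕ} {s : ℂ}
    (hs : 1 < (s + K - n).re) :
    polarSeries n c s = ∑ k ∈ Finset.range K, c k / (s + k - n) +
      ∑' k : ℕ, c (k + K) / (s + (k + K : ℕ) - n) := by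
  have h1 : Summable fun k : ℕ => c (k + K) / (s + (k + K : ℕ) - n) :=
    Summable.of_norm_bounded ((summable_nat_add_iff K).mpr hc) fun k =>
      norm_div_le_of_one_lt_re hs
  have h2 : Summable fun k : ℕ => c k / (s + k - n) := (summable_nat_add_iff K).mp h1
  exact (h2.sum_add_tsum_nat_add K).symm

theorem analyticAt_tsum_tail (hc : Summable fun k => ‖c k‖) {K : ℕ} {s : ℂ}
    (hs : 1 < (s + K - n).re) :
    AnalyticAt ℂ (fun s => ∑' k : ℕ, c (k + K) / (s + (k + K : ℕ) - n)) s := by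
  have hopen : IsOpen {s : ℂ | 1 < (s + K - n).re} :=
    isOpen_lt continuous_const (Complex.continuous_re.comp (by fun_prop))
  refine (Complex.differentiableOn_tsum_of_summable_norm ((summable_nat_add_iff K).mpr hc)
    (fun k w hw => ?_) hopen fun k w hw => norm_div_le_of_one_lt_re hw).analyticAt
    (hopen.mem_nhds hs)
  have hne : w + (k + K : ℕ) - n ≠ 0 := by
    intro h0
    have h1 := congrArg Complex.re h0
    have hw' : 1 < (w + K - n).re := hw
    simp only [Complex.sub_re, Complex.add_re, Complex.natCast_re, Complex.zero_re] at h1 hw'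
    have h2 : (0 : ℝ) ≤ k := Nat.cast_nonneg k
    push_cast at h1
    linarith
  exact DifferentiableAt.differentiableWithinAt (by fun_prop (disch := assumption))

theorem exists_one_lt_re_add_natCast (n : ℕ) (s : ℂ) : ∃ K : ℕ, 1 < (s + K - n).re := by
  obtain ⟨K, hK⟩ := exists_nat_gt (1 + n - s.re)
  refine ⟨K, ?_⟩
  simp only [Complex.sub_re, Complex.add_re, Complex.natCast_re]
  linarith

theorem eventually_one_lt_re {K : ℕ} {s₀ : ℂ} (hs : 1 < (s₀ + K - n).re) :
    ∀ᶠ s : ℂ in 𝓝 s₀, 1 < (s + K - n).re :=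
  (isOpen_lt continuous_const (Complex.continuous_re.comp
    (by fun_prop : Continuous fun s : ℂ => s + K - n))).mem_nhds hs

theorem analyticAt_const_div_add_sub (a : ℂ) {k : ℕ} {s₀ : ℂ} (h : s₀ + k - n ≠ 0) :
    AnalyticAt ℂ (fun s : ℂ => a / (s + k - n)) s₀ := by
  fun_prop (disch := assumption)

theorem analyticAt_polarSeries (hc : Summable fun k => ‖c k‖) {s₀ : ℂ}
    (h : ∀ k : ℕ, s₀ + k - n ≠ 0) : AnalyticAt ℂ (polarSeries n c) s₀ := by
  obtain ⟨K, hK⟩ := exists_one_lt_re_add_natCast n s₀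
  refine AnalyticAt.congr (f := fun s => ∑ k ∈ Finset.range K, c k / (s + k - n) +
    ∑' k : ℕ, c (k + K) / (s + (k + K : ℕ) - n)) ?_ ?_
  · refine AnalyticAt.fun_add (Finset.analyticAt_fun_sum _ fun k _ => ?_)
      (analyticAt_tsum_tail hc hK)
    exact analyticAt_const_div_add_sub _ (h k)
  · filter_upwards [eventually_one_lt_re hK] with s hs
    exact (polarSeries_eq_sum_add_tsum hc hs).symm

/-- Near `s = n - j` only the `j`-th term is singular. -/
theorem exists_polarSeries_eq_add (hc : Summable fun k => ‖c k‖) (j : ℕ) :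
    ∃ g : ℂ → ℂ, AnalyticAt ℂ g ((n : ℂ) - j) ∧
      ∀ᶠ s in 𝓝 ((n : ℂ) - j), polarSeries n c s = c j / (s + j - n) + g s := by
  obtain ⟨K₀, hK₀⟩ := exists_one_lt_re_add_natCast n ((n : ℂ) - j)
  set K := K₀ + (j + 1) with hKdef
  have hK : 1 < ((n : ℂ) - j + K - n).re := by
    have hj : (0 : ℝ) ≤ j := Nat.cast_nonneg j
    simp only [hKdef, Complex.sub_re, Complex.add_re, Complex.natCast_re] at hK₀ ⊢
    push_cast
    linarith
  refine ⟨fun s => ∑ k ∈ (Finset.range K).erase j, c k / (s + k - n) +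
    ∑' k : ℕ, c (k + K) / (s + (k + K : ℕ) - n), ?_, ?_⟩
  · refine AnalyticAt.fun_add (Finset.analyticAt_fun_sum _ fun k hk => ?_)
      (analyticAt_tsum_tail hc hK)
    refine analyticAt_const_div_add_sub _ fun h0 => (Finset.mem_erase.mp hk).1 ?_
    have : (k : ℂ) = j := by linear_combination h0
    exact_mod_cast this
  · filter_upwards [eventually_one_lt_re hK] with s hs
    have hj : j ∈ Finset.range K := Finset.mem_range.mpr (by omega)
    rw [polarSeries_eq_sum_add_tsum hc hs, ← add_assoc,
      ← Finset.add_sum_erase _ (fun k : ℕ => c k / (s + k - n)) hj]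

theorem meromorphicAt_polarSeries (hc : Summable fun k => ‖c k‖) (s₀ : ℂ) :
    MeromorphicAt (polarSeries n c) s₀ := by
  by_cases h : ∀ k : ℕ, s₀ + k - n ≠ 0
  · exact (analyticAt_polarSeries hc h).meromorphicAt
  · push Not at h
    obtain ⟨j, hj⟩ := h
    obtain rfl : s₀ = (n : ℂ) - j := by linear_combination hj
    obtain ⟨g, hg, hev⟩ := exists_polarSeries_eq_add (n := n) hc j
    refine MeromorphicAt.congr (f := fun s => c j / (s + j - n) + g s) ?_ ?_
    · refine MeromorphicAt.fun_add (MeromorphicAt.fun_div ?_ ?_) hg.meromorphicAt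
      · exact analyticAt_const.meromorphicAt
      · exact AnalyticAt.meromorphicAt (by fun_prop)
    · filter_upwards [nhdsWithin_le_nhds hev] with s hs
      exact hs.symm

/-! ### Splitting a Mellin transform at `1` -/

variable {φ : ℝ → ℂ}

theorem isBigO_rpow_of_hasSum (hc : Summable fun k => ‖c k‖)
    (hφ : ∀ u ∈ Set.Ioc (0 : ℝ) 1, HasSum (fun k : ℕ => c k * (u : ℂ) ^ ((k : ℂ) - n)) (φ u)) :
    φ =O[𝓝[>] 0] fun u : ℝ => u ^ (-(n : ℝ)) := by
  refine Asymptotics.IsBigO.of_bound (∑' k, ‖c k‖) ?_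
  filter_upwards [Ioc_mem_nhdsGT (zero_lt_one' ℝ)] with u hu
  have hle : ∀ k : ℕ, ‖c k * (u : ℂ) ^ ((k : ℂ) - n)‖ ≤ ‖c k‖ * u ^ (-(n : ℝ)) := fun k => by
    rw [norm_mul, Complex.norm_cpow_eq_rpow_re_of_pos hu.1]
    refine mul_le_mul_of_nonneg_left ?_ (norm_nonneg _)
    refine Real.rpow_le_rpow_of_exponent_ge hu.1 hu.2 ?_
    simp
  rw [← (hφ u hu).tsum_eq, Real.norm_of_nonneg (Real.rpow_nonneg hu.1.le _), ← tsum_mul_right]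
  exact tsum_of_norm_bounded (hc.mul_right _).hasSum hle

theorem setIntegral_Ioc_eq_polarSeries {s : ℂ} (hs : n < s.re) (hc : Summable fun k => ‖c k‖)
    (hφ : ∀ u ∈ Set.Ioc (0 : ℝ) 1, HasSum (fun k : ℕ => c k * (u : ℂ) ^ ((k : ℂ) - n)) (φ u)) :
    ∫ u in Set.Ioc (0 : ℝ) 1, (u : ℂ) ^ (s - 1) • φ u = polarSeries n c s := by
  have hre : ∀ k : ℕ, s.re - n ≤ (s + k - n - 1).re + 1 := fun k => by
    have h2 : (0 : ℝ) ≤ k := Nat.cast_nonneg k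
    simp only [Complex.sub_re, Complex.add_re, Complex.natCast_re, Complex.one_re]
    linarith
  have hre' : ∀ k : ℕ, -1 < (s + k - n - 1).re := fun k => by linarith [hre k]
  have hint : ∀ k : ℕ, IntegrableOn (fun u : ℝ => c k * (u : ℂ) ^ (s + k - n - 1))
      (Set.Ioc 0 1) := fun k =>
    ((intervalIntegrable_iff_integrableOn_Ioc_of_le zero_le_one).mp
      (intervalIntegral.intervalIntegrable_cpow' (hre' k))).const_mul _
  have hmain := hasSum_integral_of_summable_integral_norm (μ := volume.restrict (Set.Ioc 0 1))
    (F := fun (k : ℕ) (u : ℝ) => c k * (u : ℂ) ^ (s + k - n - 1)) hint ?_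
  · have hval : ∀ k : ℕ, ∫ u in Set.Ioc (0 : ℝ) 1, c k * (u : ℂ) ^ (s + k - n - 1) =
        c k / (s + k - n) := fun k => by
      have hne : s + k - n ≠ 0 := fun h0 => by
        have := hre' k
        rw [h0] at this
        norm_num at this
      rw [integral_const_mul, ← intervalIntegral.integral_of_le zero_le_one,
        integral_cpow (Or.inl (hre' k)), sub_add_cancel]
      simp [Complex.zero_cpow hne, div_eq_mul_inv]
    simp only [hval] at hmain
    rw [polarSeries, hmain.tsum_eq]
    refine setIntegral_congr_fun measurableSet_Ioc fun u hu => ?_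
    have hu0 : (u : ℂ) ≠ 0 := by exact_mod_cast hu.1.ne'
    rw [smul_eq_mul, ← (hφ u hu).tsum_eq, ← tsum_mul_left]
    refine tsum_congr fun k => ?_
    rw [mul_left_comm, ← Complex.cpow_add _ _ hu0]
    congr 2
    ring
  · refine Summable.of_nonneg_of_le (fun k => integral_nonneg fun u => norm_nonneg _)
      (fun k => ?_) (hc.mul_right (1 / (s.re - n)))
    have hval : ∫ u in Set.Ioc (0 : ℝ) 1, ‖c k * (u : ℂ) ^ (s + k - n - 1)‖ =
        ‖c k‖ * (1 / ((s + k - n - 1).re + 1)) := by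
      have h1 : ∀ u ∈ Set.Ioc (0 : ℝ) 1, ‖c k * (u : ℂ) ^ (s + k - n - 1)‖ =
          ‖c k‖ * u ^ (s + k - n - 1).re := fun u hu => by
        rw [norm_mul, Complex.norm_cpow_eq_rpow_re_of_pos hu.1]
      rw [setIntegral_congr_fun measurableSet_Ioc h1, integral_const_mul,
        ← intervalIntegral.integral_of_le zero_le_one, integral_rpow (Or.inl (hre' k)),
        Real.one_rpow, Real.zero_rpow (by linarith [hre' k]), sub_zero]
    rw [hval]
    have h0 : 0 < s.re - n := by linarith
    exact mul_le_mul_of_nonneg_left (one_div_le_one_div_of_le h0 (hre k)) (norm_nonneg _)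

theorem differentiable_mellin_indicator_Ioi {a : ℝ} (ha : 0 < a)
    (hcont : ContinuousOn φ (Set.Ioi 0)) (hdecay : φ =O[atTop] fun u => Real.exp (-a * u)) :
    Differentiable ℂ (mellin ((Set.Ioi 1).indicator φ)) := fun s => by
  refine mellin_differentiableAt_of_isBigO_rpow_exp (b := s.re - 1) ha ?_ ?_ ?_ (by linarith)
  · intro x hx
    obtain ⟨t, ht, hti⟩ :=
      hcont.locallyIntegrableOn (μ := volume) measurableSet_Ioi x hx
    exact ⟨t, ht, hti.indicator measurableSet_Ioi⟩
  · refine hdecay.congr' ?_ EventuallyEq.rfl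
    filter_upwards [eventually_gt_atTop 1] with u hu
    exact (Set.indicator_of_mem (s := Set.Ioi 1) hu φ).symm
  · refine (Asymptotics.isBigO_zero _ _).congr' ?_ EventuallyEq.rfl
    filter_upwards [Ioc_mem_nhdsGT (zero_lt_one' ℝ)] with u hu
    exact (Set.indicator_of_notMem (s := Set.Ioi (1 : ℝ)) (not_lt.mpr hu.2) φ).symm

theorem mellin_eq_polarSeries_add {a : ℝ} (ha : 0 < a) (hcont : ContinuousOn φ (Set.Ioi 0))
    (hdecay : φ =O[atTop] fun u => Real.exp (-a * u)) (hc : Summable fun k => ‖c k‖)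
    (hφ : ∀ u ∈ Set.Ioc (0 : ℝ) 1, HasSum (fun k : ℕ => c k * (u : ℂ) ^ ((k : ℂ) - n)) (φ u))
    {s : ℂ} (hs : n < s.re) :
    mellin φ s = polarSeries n c s + mellin ((Set.Ioi 1).indicator φ) s := by
  have hconv : MellinConvergent φ s :=
    mellinConvergent_of_isBigO_rpow (a := s.re + 1) (b := n)
      (hcont.locallyIntegrableOn measurableSet_Ioi)
      (hdecay.trans (isLittleO_exp_neg_mul_rpow_atTop ha _).isBigO) (by linarith)
      (isBigO_rpow_of_hasSum hc hφ) hs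
  have h1 : mellin ((Set.Ioi 1).indicator φ) s =
      ∫ u in Set.Ioi (1 : ℝ), (u : ℂ) ^ (s - 1) • φ u := by
    have h2 : (fun u : ℝ => (u : ℂ) ^ (s - 1) • (Set.Ioi 1).indicator φ u) =
        (Set.Ioi 1).indicator fun u : ℝ => (u : ℂ) ^ (s - 1) • φ u :=
      funext fun u => (Set.indicator_smul_apply (Set.Ioi 1)
        (fun u : ℝ => (u : ℂ) ^ (s - 1)) φ u).symm
    rw [mellin, h2, setIntegral_indicator measurableSet_Ioi, Set.Ioi_inter_Ioi]
    simp
  rw [h1, ← setIntegral_Ioc_eq_polarSeries hs hc hφ, mellin,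
    ← Set.Ioc_union_Ioi_eq_Ioi zero_le_one]
  refine setIntegral_union (Set.Ioc_disjoint_Ioi le_rfl) measurableSet_Ioi ?_ ?_
  · exact hconv.mono_set Set.Ioc_subset_Ioi_self
  · exact hconv.mono_set (Set.Ioi_subset_Ioi zero_le_one)

end polarSeries

/-! ### The Barnes zeta-function -/

/-- `1 / (Γ(s) (s + k))` extends holomorphically to `s = -k`, with value `(-1)^k k!`. -/
theorem exists_inv_Gamma_eq (k : ℕ) : ∃ g : ℂ → ℂ, Differentiable ℂ g ∧
    g (-k) = (-1) ^ k * (k.factorial : ℂ) ∧ ∀ s : ℂ, (Complex.Gamma s)⁻¹ = g s * (s + k) := by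
  induction k with
  | zero =>
    refine ⟨fun s => (Complex.Gamma (s + 1))⁻¹, ?_, by simp, fun s => ?_⟩
    · exact Complex.differentiable_one_div_Gamma.comp (by fun_prop)
    · rw [Complex.one_div_Gamma_eq_self_mul_one_div_Gamma_add_one]
      simp [mul_comm]
  | succ k ih =>
    obtain ⟨g, hg, hval, heq⟩ := ih
    refine ⟨fun s => s * g (s + 1), differentiable_id.mul (hg.comp (by fun_prop)), ?_, fun s => ?_⟩
    · have h1 : -((k + 1 : ℕ) : ℂ) + 1 = -k := by push_cast; ring
      simp only
      rw [h1, hval, Nat.factorial_succ]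
      push_cast
      ring
    · rw [Complex.one_div_Gamma_eq_self_mul_one_div_Gamma_add_one, heq]
      push_cast
      ring

/-- `z ↦ z^s` is multiplicative on `z` in the closed upper and `l` in the open lower half-plane. -/
theorem cpow_mul_of_im_neg {l z : ℂ} (hl : l.im < 0) (hz : 0 ≤ z.im) (hz0 : z ≠ 0) (s : ℂ) :
    (l * z) ^ s = l ^ s * z ^ s := by
  have hl0 : l ≠ 0 := by rintro rfl; simp at hl
  have harg : l.arg + z.arg ∈ Set.Ioc (-Real.pi) Real.pi := by
    have h1 := Complex.arg_neg_iff.mpr hl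
    have h2 := Complex.arg_nonneg_iff.mpr hz
    have h3 := Complex.neg_pi_lt_arg l
    have h4 := Complex.arg_le_pi z
    constructor <;> linarith
  rw [Complex.cpow_def_of_ne_zero (mul_ne_zero hl0 hz0), Complex.cpow_def_of_ne_zero hl0,
    Complex.cpow_def_of_ne_zero hz0, ← Complex.exp_add,
    (Complex.log_mul_eq_add_log_iff hl0 hz0).mpr harg, add_mul]

theorem toMeromorphicNFOn_eventuallyEq_of_analyticAt {f g : ℂ → ℂ}
    (hf : MeromorphicOn f Set.univ) {x : ℂ} (hg : AnalyticAt ℂ g x) (hfg : f =ᶠ[𝓝[≠] x] g) :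
    toMeromorphicNFOn f Set.univ =ᶠ[𝓝 x] g := by
  have h1 := (hf.toMeromorphicNFOn_eq_self_on_nhdsNE (Set.mem_univ x)).trans hfg
  exact ((meromorphicNFOn_toMeromorphicNFOn f Set.univ
    (Set.mem_univ x)).eventuallyEq_nhdsNE_iff_eventuallyEq_nhds hg.meromorphicNFAt).mp h1

/-- Riemann's method for the Barnes zeta-function with parameters `a` and `ω_j` in the closed upper
half-plane, all of which are rotated into the right half-plane by a factor `l` in the lower one. If
`e^(-lau) / ∏ (1 - e^(-lω_j u)) = ∑ c_k u^(k-n)` for `0 < u ≤ 1`, then `ζ(s)` has a meromorphic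
continuation, and the `c_k` give its values at the non-positive integers. -/
theorem exists_isBarnesZeta {n : ℕ} (hn : 1 ≤ n) {a l : ℂ} {ω : Fin n → ℂ} {c : ℕ → ℂ}
    (hl : l.im < 0) (ha : 0 ≤ a.im) (hω : ∀ j, 0 ≤ (ω j).im) (hla : 0 < (l * a).re)
    (hlω : ∀ j, 0 < (l * ω j).re) (hc : Summable fun k => ‖c k‖)
    (hφ : ∀ u ∈ Set.Ioc (0 : ℝ) 1, HasSum (fun k : ℕ => c k * (u : ℂ) ^ ((k : ℂ) - n))
      (Complex.exp (-(l * a * u)) * ∏ j, (1 - Complex.exp (-(l * ω j * u)))⁻¹)) :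
    ∃ Z : ℂ → ℂ, IsBarnesZeta a ω Z ∧ ∀ k : ℕ, AnalyticAt ℂ Z (-k) ∧
      Z (-k) = l ^ (-(k : ℤ)) * ((-1) ^ k * (k.factorial : ℂ)) * c (k + n) := by
  have hl0 : l ≠ 0 := by rintro rfl; simp at hl
  set φ : ℝ → ℂ := fun u =>
    Complex.exp (-(l * a * u)) * ∏ j, (1 - Complex.exp (-(l * ω j * u)))⁻¹ with hφdef
  have hlt : ∀ u : ℝ, 0 < u → ∀ j, ‖Complex.exp (-(l * ω j * u))‖ < 1 := fun u hu j => by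
    rw [Complex.norm_exp, Real.exp_lt_one_iff]
    have h1 : 0 < (l * ω j).re * u := mul_pos (hlω j) hu
    have h2 : (-(l * ω j * u)).re = -((l * ω j).re * u) := by
      rw [Complex.neg_re, Complex.re_mul_ofReal]
    linarith
  have hcont : ContinuousOn φ (Set.Ioi 0) := by
    refine ContinuousOn.mul (by fun_prop) (continuousOn_finsetProd _ fun j _ => ?_)
    refine ContinuousOn.inv₀ (by fun_prop) fun u hu h0 => ?_
    have := hlt u hu j
    rw [← sub_eq_zero.mp h0, norm_one] at this
    exact lt_irrefl _ this
  have hdecay : φ =O[atTop] fun u => Real.exp (-(l * a).re * u) := by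
    have h1 : (fun u : ℝ => Complex.exp (-(l * a * u))) =O[atTop]
        fun u => Real.exp (-(l * a).re * u) := by
      refine Asymptotics.IsBigO.of_bound 1 (Eventually.of_forall fun u => ?_)
      rw [Complex.norm_exp, one_mul, Real.norm_of_nonneg (Real.exp_pos _).le, Complex.neg_re,
        Complex.re_mul_ofReal, neg_mul]
    have h2 : Tendsto (fun u : ℝ => ∏ j, (1 - Complex.exp (-(l * ω j * u)))⁻¹) atTop
        (𝓝 (∏ _j : Fin n, 1)) := by
      refine tendsto_finsetProd _ fun j _ => ?_
      have h3 : Tendsto (fun u : ℝ => Complex.exp (-(l * ω j * u))) atTop (𝓝 0) := by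
        rw [tendsto_zero_iff_norm_tendsto_zero]
        have h4 : ∀ u : ℝ, ‖Complex.exp (-(l * ω j * u))‖ = Real.exp (-((l * ω j).re * u)) :=
          fun u => by rw [Complex.norm_exp, Complex.neg_re, Complex.re_mul_ofReal]
        simp only [h4]
        exact Real.tendsto_exp_neg_atTop_nhds_zero.comp (tendsto_id.const_mul_atTop (hlω j))
      simpa using (h3.const_sub 1).inv₀ (by simp)
    simpa only [mul_one] using h1.mul (h2.isBigO_one ℝ)
  set M : ℂ → ℂ := mellin ((Set.Ioi 1).indicator φ) with hM
  have hMd : Differentiable ℂ M := differentiable_mellin_indicator_Ioi hla hcont hdecay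
  have hMan : ∀ s, AnalyticAt ℂ M s := fun s => hMd.analyticAt s
  have hpow : ∀ s, AnalyticAt ℂ (fun s : ℂ => l ^ s) s := fun s =>
    Differentiable.analyticAt (fun s => by
      exact (differentiableAt_id.const_cpow (Or.inl hl0))) s
  have hΓ : ∀ s, AnalyticAt ℂ (fun s : ℂ => (Complex.Gamma s)⁻¹) s := fun s =>
    Complex.differentiable_one_div_Gamma.analyticAt s
  set f : ℂ → ℂ := fun s => l ^ s * (Complex.Gamma s)⁻¹ * (polarSeries n c s + M s) with hf
  have hfm : MeromorphicOn f Set.univ := fun s _ =>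
    ((hpow s).mul (hΓ s)).meromorphicAt.mul
      ((meromorphicAt_polarSeries hc s).add (hMan s).meromorphicAt)
  refine ⟨toMeromorphicNFOn f Set.univ, ⟨fun s hs => ?_, meromorphicNFOn_toMeromorphicNFOn _ _⟩,
    fun k => ?_⟩
  · have hfs : AnalyticAt ℂ f s := by
      refine ((hpow s).mul (hΓ s)).mul ((analyticAt_polarSeries hc fun k h0 => ?_).add (hMan s))
      have h1 := congrArg Complex.re h0
      have h2 : (0 : ℝ) ≤ k := Nat.cast_nonneg k
      simp only [Complex.sub_re, Complex.add_re, Complex.natCast_re, Complex.zero_re] at h1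
      linarith
    rw [(toMeromorphicNFOn_eventuallyEq_of_analyticAt hfm hfs EventuallyEq.rfl).eq_of_nhds]
    have h1 := hasSum_mellin_barnes hn hla hlω hs
    rw [mellin_eq_polarSeries_add hla hcont hdecay hc hφ hs] at h1
    have hΓ0 : Complex.Gamma s ≠ 0 := Complex.Gamma_ne_zero_of_re_pos
      (lt_of_le_of_lt (Nat.cast_nonneg n) hs)
    refine (h1.mul_left (l ^ s * (Complex.Gamma s)⁻¹)).congr_fun fun m => ?_
    have him : 0 ≤ (a + ∑ j, ω j * (m j : ℂ)).im := by
      rw [Complex.add_im, Complex.im_sum]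
      refine add_nonneg ha (Finset.sum_nonneg fun j _ => ?_)
      rw [← Complex.ofReal_natCast, Complex.im_mul_ofReal]
      exact mul_nonneg (hω j) (Nat.cast_nonneg _)
    have hfac : l * a + ∑ j, l * ω j * (m j : ℂ) = l * (a + ∑ j, ω j * (m j : ℂ)) := by
      rw [mul_add, Finset.mul_sum]
      simp only [mul_assoc]
    have hre : 0 < (l * (a + ∑ j, ω j * (m j : ℂ))).re := by
      rw [← hfac, Complex.add_re, Complex.re_sum]
      refine add_pos_of_pos_of_nonneg hla (Finset.sum_nonneg fun j _ => ?_)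
      rw [← Complex.ofReal_natCast, Complex.re_mul_ofReal]
      exact mul_nonneg (hlω j).le (Nat.cast_nonneg _)
    have hz0 : a + ∑ j, ω j * (m j : ℂ) ≠ 0 := fun h0 => by
      rw [h0, mul_zero, Complex.zero_re] at hre
      exact lt_irrefl _ hre
    rw [hfac, cpow_mul_of_im_neg hl him hz0]
    have h2 : l ^ s ≠ 0 := by rw [Complex.cpow_ne_zero_iff]; exact Or.inl hl0
    field_simp
  · obtain ⟨g, hg, hgval, hgeq⟩ := exists_inv_Gamma_eq k
    obtain ⟨r, hr, hreq⟩ := exists_polarSeries_eq_add (n := n) hc (k + n)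
    have hk : (n : ℂ) - ((k + n : ℕ) : ℂ) = -k := by push_cast; ring
    rw [hk] at hr hreq
    -- the zero of `1 / Γ` at `-k` cancels the pole of the polar series and kills everything else
    set G : ℂ → ℂ := fun s => l ^ s * (g s * c (k + n) + (Complex.Gamma s)⁻¹ * (r s + M s)) with hG
    have hGan : AnalyticAt ℂ G (-k) := (hpow _).mul
      (((hg.analyticAt _).mul analyticAt_const).add ((hΓ _).mul (hr.add (hMan _))))
    have hfG : f =ᶠ[𝓝[≠] (-(k : ℂ))] G := by
      filter_upwards [nhdsWithin_le_nhds hreq, self_mem_nhdsWithin] with s hs hsk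
      have hsk' : s + k ≠ 0 := fun h0 => hsk (eq_neg_of_add_eq_zero_left h0)
      have h1 : s + ((k + n : ℕ) : ℂ) - n = s + k := by push_cast; ring
      rw [hf, hG]
      simp only
      rw [hs, h1, mul_assoc, add_assoc, mul_add (Complex.Gamma s)⁻¹]
      congr 2
      rw [hgeq s]
      field_simp
    have hev := toMeromorphicNFOn_eventuallyEq_of_analyticAt hfm hGan hfG
    refine ⟨hGan.congr hev.symm, ?_⟩
    rw [hev.eq_of_nhds, hG]
    simp only
    rw [hgval, hgeq, neg_add_cancel, mul_zero, zero_mul, add_zero, zpow_neg, zpow_natCast,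
      Complex.cpow_neg, Complex.cpow_natCast]
    ring

theorem IsBarnesZeta.barnesZeta_eq {n : ℕ} {a : ℂ} {ω : Fin n → ℂ} {Z : ℂ → ℂ}
    (h : IsBarnesZeta a ω Z) : (fun s => barnesZeta s a ω) = Z := by
  have hex : ∃ Z : ℂ → ℂ, IsBarnesZeta a ω Z := ⟨Z, h⟩
  funext s
  rw [barnesZeta, dif_pos hex, hex.choose_spec.unique h]

/-! ### Specialization to `1, η, …, η^(n-1)` -/

theorem sum_etaRoot_pow {n : ℕ} (hn : 2 ≤ n) :
    ∑ j : Fin n, etaRoot n ^ (j : ℕ) = 2 * (1 / (1 - etaRoot n)) := by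
  have h1 : etaRoot n ≠ 1 := fun h => by
    have h2 := im_etaRoot_pow_pos (n := n) one_pos hn
    rw [pow_one, h] at h2
    simp at h2
  rw [Fin.sum_univ_eq_sum_range (fun j => etaRoot n ^ j), geom_sum_eq h1,
    etaRoot_pow_self (by omega)]
  have h3 : etaRoot n - 1 ≠ 0 := sub_ne_zero.mpr h1
  have h4 : 1 - etaRoot n ≠ 0 := sub_ne_zero.mpr h1.symm
  field_simp
  ring

/-- A rotation into the right half-plane: multiplication by `e^(-iθ)`, `θ = π (n - 1) / (2n)`, maps
the directions `0, π/n, …, π(n-1)/n` into `[-θ, θ]`. -/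
theorem exists_rotation {n : ℕ} (hn : 2 ≤ n) {δ : ℝ} (hδ : 0 < δ) :
    ∃ l : ℂ, ‖l‖ = δ ∧ l.im < 0 ∧ ∀ j < n, 0 < (l * etaRoot n ^ j).re := by
  have hn' : (2 : ℝ) ≤ n := by exact_mod_cast hn
  have hn0 : (0 : ℝ) < n := by linarith
  set θ : ℝ := Real.pi * (n - 1) / (2 * n) with hθ
  have hθ0 : 0 < θ := div_pos (mul_pos Real.pi_pos (by linarith)) (by linarith)
  have hθ1 : θ < Real.pi / 2 := by
    rw [hθ, div_lt_div_iff₀ (by linarith) two_pos]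
    nlinarith [Real.pi_pos]
  refine ⟨δ * Complex.exp ((-θ : ℝ) * Complex.I), ?_, ?_, fun j hj => ?_⟩
  · rw [norm_mul, Complex.norm_exp_ofReal_mul_I, mul_one, Complex.norm_real,
      Real.norm_of_nonneg hδ.le]
  · rw [Complex.im_ofReal_mul, Complex.exp_ofReal_mul_I_im, Real.sin_neg]
    have := Real.sin_pos_of_pos_of_lt_pi hθ0 (by linarith [Real.pi_pos])
    nlinarith
  · rw [mul_assoc, etaRoot_pow, ← Complex.exp_add, ← add_mul, ← Complex.ofReal_add,
      Complex.re_ofReal_mul, Complex.exp_ofReal_mul_I_re]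
    have hj0 : (0 : ℝ) ≤ j := Nat.cast_nonneg j
    have hj1 : (j : ℝ) ≤ n - 1 := by
      have : (j : ℝ) + 1 ≤ n := by exact_mod_cast hj
      linarith
    have h1 : 0 ≤ Real.pi * j / n := by positivity
    have h2 : Real.pi * j / n ≤ 2 * θ := by
      have : 2 * θ = Real.pi * (n - 1) / n := by rw [hθ]; field_simp
      rw [this]
      gcongr
    exact mul_pos hδ (Real.cos_pos_of_mem_Ioo ⟨by linarith, by linarith⟩)

theorem exp_mul_prod_eq_prod_halfDivSinh {n : ℕ} (hn : 2 ≤ n) {z : ℂ} (hz : z ≠ 0) :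
    Complex.exp (-(1 / (1 - etaRoot n) * z)) *
        ∏ j : Fin n, (1 - Complex.exp (-(etaRoot n ^ (j : ℕ) * z)))⁻¹ =
      (etaRoot n ^ (n * (n - 1) / 2))⁻¹ * (z ^ n)⁻¹ *
        ∏ j : Fin n, halfDivSinh (etaRoot n ^ (j : ℕ) * z) := by
  have hE : etaRoot n ^ (n * (n - 1) / 2) ≠ 0 := pow_ne_zero _ (etaRoot_ne_zero n)
  have hzn : z ^ n ≠ 0 := pow_ne_zero _ hz
  have h1 : ∀ x : ℂ, (2 * Complex.sinh (x / 2))⁻¹ =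
      Complex.exp (-(x / 2)) * (1 - Complex.exp (-x))⁻¹ := fun x => by
    have h2 := two_mul_exp_mul_sinh (-x)
    rw [neg_div, Complex.sinh_neg] at h2
    have h3 : 1 - Complex.exp (-x) = Complex.exp (-(x / 2)) * (2 * Complex.sinh (x / 2)) := by
      linear_combination h2
    rw [h3, mul_inv (Complex.exp _), mul_inv_cancel_left₀ (Complex.exp_ne_zero _)]
  have h4 : Complex.exp (-(1 / (1 - etaRoot n) * z)) =
      ∏ j : Fin n, Complex.exp (-(etaRoot n ^ (j : ℕ) * z / 2)) := by
    rw [← Complex.exp_sum, Finset.sum_neg_distrib, ← Finset.sum_div, ← Finset.sum_mul,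
      sum_etaRoot_pow hn]
    congr 1
    ring
  rw [h4, ← Finset.prod_mul_distrib, prod_halfDivSinh hz,
    ← Fin.prod_univ_eq_prod_range (fun j => 2 * Complex.sinh (etaRoot n ^ j * z / 2)),
    div_eq_mul_inv, ← Finset.prod_inv_distrib]
  simp only [h1]
  rw [← mul_assoc, show (etaRoot n ^ (n * (n - 1) / 2))⁻¹ * (z ^ n)⁻¹ *
    (etaRoot n ^ (n * (n - 1) / 2) * z ^ n) = 1 by field_simp, one_mul]

theorem exists_isBarnesZeta_etaRoot {n : ℕ} (hn : 2 ≤ n) :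
    ∃ Z : ℂ → ℂ, IsBarnesZeta (1 / (1 - etaRoot n)) (fun j : Fin n => etaRoot n ^ (j : ℕ)) Z ∧
      ∀ k : ℕ, AnalyticAt ℂ Z (-k) ∧ Z (-k) = (-1) ^ k * (k.factorial : ℂ) *
        (PowerSeries.coeff (k + n) (sinhProdSeries n) / etaRoot n ^ (n * (n - 1) / 2)) := by
  obtain ⟨ε, hε, hball⟩ := Metric.eventually_nhds_iff_ball.mp (hasTaylorSeries_prod_halfDivSinh n)
  obtain ⟨l, hlnorm, hlim, hlre⟩ := exists_rotation hn (half_pos hε)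
  have hl0 : l ≠ 0 := by rintro rfl; simp at hlim
  have hlz : ∀ u ∈ Set.Ioc (0 : ℝ) 1, l * u ∈ Metric.ball (0 : ℂ) ε := fun u hu => by
    rw [mem_ball_zero_iff, norm_mul, hlnorm, Complex.norm_real, Real.norm_of_nonneg hu.1.le]
    nlinarith [hu.1, hu.2]
  have ha : 1 / (1 - etaRoot n) = (∑ j : Fin n, etaRoot n ^ (j : ℕ)) * ((1 / 2 : ℝ) : ℂ) := by
    rw [sum_etaRoot_pow hn]
    push_cast
    ring
  have him : ∀ j : Fin n, 0 ≤ (etaRoot n ^ (j : ℕ)).im := fun j => by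
    rcases Nat.eq_zero_or_pos (j : ℕ) with h | h
    · simp [h]
    · exact (im_etaRoot_pow_pos h j.2).le
  set E : ℂ := etaRoot n ^ (n * (n - 1) / 2) with hE
  set c : ℕ → ℂ := fun k => E⁻¹ * (l ^ n)⁻¹ * (PowerSeries.coeff k (sinhProdSeries n) * l ^ k)
    with hc
  have ha_im : 0 ≤ (1 / (1 - etaRoot n)).im := by
    rw [ha, Complex.im_mul_ofReal, Complex.im_sum]
    exact mul_nonneg (Finset.sum_nonneg fun j _ => him j) (by norm_num)
  have hla : 0 < (l * (1 / (1 - etaRoot n))).re := by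
    rw [ha, ← mul_assoc, Complex.re_mul_ofReal, Finset.mul_sum, Complex.re_sum]
    have : Nonempty (Fin n) := ⟨⟨0, by omega⟩⟩
    exact mul_pos (Finset.sum_pos (fun j _ => hlre j j.2) Finset.univ_nonempty) (by norm_num)
  have hcs : Summable fun k => ‖c k‖ := by
    have h1 := (hball (l * (1 : ℝ)) (hlz 1 ⟨one_pos, le_rfl⟩)).summable
    simp only [Complex.ofReal_one, mul_one] at h1
    exact (h1.mul_left _).norm
  have hφ : ∀ u ∈ Set.Ioc (0 : ℝ) 1, HasSum (fun k : ℕ => c k * (u : ℂ) ^ ((k : ℂ) - n))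
      (Complex.exp (-(l * (1 / (1 - etaRoot n)) * u)) *
        ∏ j : Fin n, (1 - Complex.exp (-(l * etaRoot n ^ (j : ℕ) * u)))⁻¹) := by
    intro u hu
    have hu0 : (u : ℂ) ≠ 0 := by exact_mod_cast hu.1.ne'
    have h1 := (hball (l * u) (hlz u hu)).mul_left (E⁻¹ * ((l * u) ^ n)⁻¹)
    rw [hE, ← exp_mul_prod_eq_prod_halfDivSinh hn (mul_ne_zero hl0 hu0), ← hE] at h1
    have harg : ∀ x : ℂ, l * x * u = x * (l * u) := fun x => by ring
    simp only [harg]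
    refine h1.congr_fun fun k => ?_
    rw [Complex.cpow_sub _ _ hu0, Complex.cpow_natCast, Complex.cpow_natCast, hc]
    simp only
    rw [mul_pow, mul_pow]
    field_simp
  obtain ⟨Z, hZ, hval⟩ := exists_isBarnesZeta (n := n) (by omega) hlim ha_im him hla
    (fun j => hlre j j.2) hcs hφ
  refine ⟨Z, hZ, fun k => ⟨(hval k).1, ?_⟩⟩
  rw [(hval k).2, hc, zpow_neg, zpow_natCast]
  simp only
  rw [pow_add]
  field_simp

end

theorem corollary6p2 (p : ℤ) (n : ℕ) (hn : 2 ≤ n) :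
    (Summable fun m : {m : ℤ // m ≠ 0} => sinhTerm n p m) ∧
    calZ n (2 * p + 1) * ∑' m : {m : ℤ // m ≠ 0}, sinhTerm n p m =
      -(2 ^ (n - 1) * (2 * Real.pi * Complex.I) ^ (2 * p + 1 - (n : ℤ)) /
          etaRoot n ^ (n * (n - 1) / 2)) *
        ∑ m ∈ tuplesWithSum n p, ∏ ν : Fin n,
          bernoulliHalf (2 * m ν) / ((2 * m ν).factorial : ℂ) *
            etaRoot n ^ (2 * (ν : ℕ) * m ν) ∧
    ((n : ℤ) ≤ 2 * p →
      IsBarnesZeta (1 / (1 - etaRoot n)) (fun j : Fin n => etaRoot n ^ (j : ℕ))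
        (fun s => barnesZeta s (1 / (1 - etaRoot n)) fun j : Fin n => etaRoot n ^ (j : ℕ)) ∧
      AnalyticAt ℂ
        (fun s => barnesZeta s (1 / (1 - etaRoot n)) fun j : Fin n => etaRoot n ^ (j : ℕ))
        ((n : ℂ) - 2 * p) ∧
      calZ n (2 * p + 1) * ∑' m : {m : ℤ // m ≠ 0}, sinhTerm n p m =
        (2 * Real.pi * Complex.I) ^ (2 * p + 1 - (n : ℤ)) * (-1) ^ (1 - (n : ℤ)) * 2 ^ (n - 1) /
            ((2 * p - n).toNat.factorial : ℂ) *
          barnesZeta ((n : ℂ) - 2 * p) (1 / (1 - etaRoot n))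
            fun j : Fin n => etaRoot n ^ (j : ℕ)) := by
  have hid := calZ_mul_tsum_sinhTerm hn p
  rw [pi_I_mul_sinhKernelResidueZero n (by omega) p, ← neg_mul] at hid
  refine ⟨(summable_sinhTerm hn p).subtype _, hid, fun hp => ?_⟩
  obtain ⟨Z, hZ, hval⟩ := exists_isBarnesZeta_etaRoot hn
  have hbZ := hZ.barnesZeta_eq
  have hbZs := congrFun hbZ ((n : ℂ) - 2 * p)
  rw [hbZ]
  lift p to ℕ using by omega
  obtain ⟨k, hk⟩ := Nat.exists_eq_add_of_le' (show n ≤ 2 * p by omega)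
  have hs : (n : ℂ) - 2 * ((p : ℤ) : ℂ) = -k := by
    have : (2 * p : ℂ) = k + n := by exact_mod_cast hk
    push_cast
    linear_combination -this
  have hnat : (2 * (p : ℤ) - n).toNat = k := by omega
  rw [hs] at hbZs ⊢
  refine ⟨hZ, (hval k).1, ?_⟩
  rw [hid, hbZs, (hval k).2, ← hk, coeff_sinhProdSeries, hnat]
  have hfac : (k.factorial : ℂ) ≠ 0 := by exact_mod_cast k.factorial_ne_zero
  -- `(-1)^(1-n) (-1)^k = -1`, since `k + n = 2p` is even
  have hsign : (-1 : ℂ) ^ (1 - (n : ℤ)) * (-1) ^ k = -1 := by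
    rw [← zpow_natCast, ← zpow_add₀ (by norm_num)]
    refine Odd.neg_one_zpow ⟨(p : ℤ) - n, ?_⟩
    omega
  have hcancel : (k.factorial : ℂ)⁻¹ * k.factorial = 1 := inv_mul_cancel₀ hfac
  generalize (∑ m ∈ tuplesWithSum _ _, _ : ℂ) = S
  generalize (2 * Real.pi * Complex.I) ^ (2 * (p : ℤ) + 1 - (n : ℤ)) = A
  generalize etaRoot n ^ (n * (n - 1) / 2) = E
  linear_combination (-(2 ^ (n - 1) * A / E * S)) * hsign -
    (A * (-1) ^ (1 - (n : ℤ)) * 2 ^ (n - 1) * (-1) ^ k * S / E) * hcancel
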